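/- Let $S^1=[0,2\pi]/(0\sim 2\pi)$ with arc length, let $\Omega=[0,\pi]\subset S^1$, and let $D=-\partial_x^2$. A function $K(x,\tilde x;t)$ on $S^1\times S^1$, continuous for $t>0$, is called a fundamental solution if for every continuous $f:S^1\to\mathbb R$ the function $u(x;t)=\int_{S^1}K(x,\tilde x;t)f(\tilde x)\,d\tilde x$ is a classical solution of $\partial_tu+Du=0$ for $t>0$, with $u(x';t)\to f(x)$ as $x'\to x$, $t\downarrow0$. Let $\alpha\in\mathbb C$ with $\Re(\alpha)<1$. Let $\rho:[0,\pi]\to\mathbb C$ be smooth, and let $\phi:(0,\pi)\to\mathbb C$ be smooth and such that $x^{\alpha}\phi(x)$ extends smoothly to $[0,\pi)$ and $(\pi-x)^{\alpha}\phi(x)$ extends smoothly to $(0,\pi]$. For an endpoint $y\in\partial\Omega=\{0,\pi\}$ let $r$ be the distance to $y$ ($r=x$ for $y=0$, $r=\pi-x$ for $y=\pi$), and let $\phi_k(y)$ and $\rho_\ell(y)$ be the coefficients of the one-sided Taylor series at $r=0$ (factorials included) $$r^{\alpha}\phi\sim\sum_{k\ge0}\phi_k(y)\,r^k,\qquad \rho\sim\sum_{\ell\ge0}\rho_\ell(y)\,r^\ell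 .$$ Then a fundamental solution $K$ exists, and for every fundamental solution $K$ the heat content $$\beta(t)=\int_\Omega\int_\Omega K(x,\tilde x;t)\,\phi(x)\,\rho(\tilde x)\,d\tilde x\,dx$$ has the complete asymptotic expansion $$\beta(t)\sim\sum_{n=0}^\infty t^n\beta_n^{\Omega}+\sum_{j=0}^\infty t^{(1+j-\alpha)/2}\beta_{j,\alpha}^{\partial\Omega}\qquad(t\downarrow0)$$ with $$\beta_n^{\Omega}=\frac{(-1)^n}{n!}\int_\Omega\phi\cdot D^n\rho\,dx,\qquad \beta_{j,\alpha}^{\partial\Omega}=\sum_{y\in\{0,\pi\}}\ \sum_{k+\ell=j}c_{k,\ell,\alpha}\,\phi_k(y)\,\rho_\ell(y),$$ $$c_{k,\ell,\alpha}=(-1)^{\ell+1}\frac1{\sqrt{4\pi}}\int_0^\infty\int_0^\infty e^{-(u+\tilde u)^2/4}\,u^{k-\alpha}\,\tilde u^{\ell}\,du\,d\tilde u .$$ The expansion means that for all integers $N,J\ge0$ $$\beta(t)-\sum_{n<N}t^n\beta_n^\Omega-\sum_{j<J}t^{(1+j-\alpha)/2}\beta_{j,\alpha}^{\partial\Omega}=O\big(t^N+t^{(1+J-\Re\alpha)/2}\big)\qquad(t\downarrow0).$$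 -/

import Mathlib

open scoped Topology ContDiff Real

noncomputable section

namespace CircleHeat

/-- The circle `S¹ = [0, 2π]` with `0 ∼ 2π`; its volume measure is arc length, of total mass `2π`,
and a real coordinate `x` is coerced to the point it represents. -/
abbrev S1 : Type := AddCircle (2 * π)

instance fact_two_pi_pos : Fact ((0 : ℝ) < 2 * π) := ⟨Real.two_pi_pos⟩

/-- The operator `D = -∂ₓ²`, in the coordinate `x`. -/
def opD {E : Type*} [NormedAddCommGroup E] [NormedSpace ℝ E] (f : ℝ → E) : ℝ → E :=
  fun x => -deriv (deriv f) x

/-- `u` is a classical solution on the circle, for `t > 0`, of `∂ₜ u + D u = 0`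
with the continuous initial condition `u(·; 0) = f`, which is attained continuously. -/
structure IsHeatSolution (f : C(S1, ℝ)) (u : S1 → ℝ → ℝ) : Prop where
  differentiable_time : ∀ (x : S1) (t : ℝ), 0 < t → DifferentiableAt ℝ (u x) t
  contDiff_space : ∀ t : ℝ, 0 < t → ContDiff ℝ 2 (fun x : ℝ => u (x : S1) t)
  heat_equation : ∀ (x t : ℝ), 0 < t →
    deriv (u (x : S1)) t + opD (fun y : ℝ => u (y : S1) t) x = 0
  initial_condition : ∀ x : S1,
    Filter.Tendsto (fun p : S1 × ℝ => u p.1 p.2) (𝓝 x ×ˢ 𝓝[>] (0 : ℝ)) (𝓝 (f x))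

/-- `K(x, y; t)` is a fundamental solution of the heat equation (a heat kernel) on the circle:
it is continuous for `t > 0`, and `u(x; t) = ∫ K(x, y; t) f(y) dy` solves the heat equation
with initial condition `f`, for every continuous `f`. -/
structure IsFundamentalSolution (K : S1 → S1 → ℝ → ℝ) : Prop where
  continuousOn :
    ContinuousOn (fun p : S1 × S1 × ℝ => K p.1 p.2.1 p.2.2) {p : S1 × S1 × ℝ | 0 < p.2.2}
  solves : ∀ f : C(S1, ℝ), IsHeatSolution f (fun x t => ∫ y : S1, K x y t * f y)

/-- The heat content of `Ω = [0, π] ⊂ S¹` for the initial temperature `φ` and the specific heat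
`ρ`, both given as functions of the coordinate in `[0, π]` (values elsewhere are not used). -/
def heatContent (K : S1 → S1 → ℝ → ℝ) (φ ρ : ℝ → ℂ) (t : ℝ) : ℂ :=
  ∫ x in (0 : ℝ)..π, ∫ y in (0 : ℝ)..π, (K (x : S1) (y : S1) t : ℂ) * φ x * ρ y

/-- `r^α f(r)`, for `0 < r < π`, extends to the function `F`, smooth on `[0, π)`. -/
structure IsRegularPart (α : ℂ) (f F : ℝ → ℂ) : Prop where
  contDiffOn : ContDiffOn ℝ ∞ F (Set.Ico 0 π)
  eq_of_mem : ∀ r ∈ Set.Ioo (0 : ℝ) π, F r = (r : ℂ) ^ α * f r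

/-- A function in the coordinate `r = π - x`, the distance to the endpoint `π`. -/
def reflect (f : ℝ → ℂ) : ℝ → ℂ := fun r => f (π - r)

/-- The coefficient of `r^k` in the one-sided Taylor series of `F` at `r = 0`, `r ≥ 0`. -/
def taylorCoeff (F : ℝ → ℂ) (k : ℕ) : ℂ :=
  iteratedDerivWithin k F (Set.Ico 0 π) 0 / (k.factorial : ℂ)

/-- `c_{k,ℓ,α} = (-1)^{ℓ+1} (4π)^{-1/2} ∫₀^∞ ∫₀^∞ e^{-(u+v)²/4} u^{k-α} v^ℓ du dv`. -/
def c (k l : ℕ) (α : ℂ) : ℂ :=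
  (-1) ^ (l + 1) * (1 / (Real.sqrt (4 * π) : ℂ)) *
    ∫ v in Set.Ioi (0 : ℝ), ∫ u in Set.Ioi (0 : ℝ),
      (Real.exp (-(u + v) ^ 2 / 4) : ℂ) * (u : ℂ) ^ ((k : ℂ) - α) * (v : ℂ) ^ l

/-- The interior coefficient `β_n^Ω = ((-1)^n / n!) ∫_Ω φ · Dⁿρ dx`. -/
def interiorCoeff (φ ρ : ℝ → ℂ) (n : ℕ) : ℂ :=
  (-1) ^ n / (n.factorial : ℂ) * ∫ x in (0 : ℝ)..π, φ x * (opD^[n] ρ) x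

/-- The contribution `∑_{k+ℓ=j} c_{k,ℓ,α} φ_k ρ_ℓ` of one endpoint, where `φ_k` and `ρ_ℓ` are
the Taylor coefficients of `F` (which stands for `r^α φ`) and of `G` (which stands for `ρ`),
as functions of the distance `r` to that endpoint. -/
def endpointCoeff (α : ℂ) (F G : ℝ → ℂ) (j : ℕ) : ℂ :=
  ∑ p ∈ Finset.HasAntidiagonal.antidiagonal j, c p.1 p.2 α * taylorCoeff F p.1 * taylorCoeff G p.2

/-- The boundary coefficient `β_{j,α}^{∂Ω}`: integral over `∂Ω = {0, π}` in counting measure.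
`F₀` and `Fπ` are the regular parts of `φ` at the two endpoints. -/
def boundaryCoeff (α : ℂ) (F₀ Fπ ρ : ℝ → ℂ) (j : ℕ) : ℂ :=
  endpointCoeff α F₀ ρ j + endpointCoeff α Fπ (reflect ρ) j

/-- The complete asymptotic expansion, as `t ↓ 0`,
`β(t) ∼ ∑_n tⁿ A_n + ∑_j t^{(1+j-α)/2} B_j`: after any finite truncations of the two series
the error is of the order of the first powers left out. -/
def HasHeatExpansion (α : ℂ) (β : ℝ → ℂ) (A B : ℕ → ℂ) : Prop :=
  ∀ N J : ℕ,
    (fun t : ℝ => β t - ∑ n ∈ Finset.range N, (t : ℂ) ^ n * A n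
        - ∑ j ∈ Finset.range J, (t : ℂ) ^ ((1 + (j : ℂ) - α) / 2) * B j)
      =O[𝓝[>] (0 : ℝ)]
    (fun t : ℝ => t ^ N + t ^ ((1 + (J : ℝ) - α.re) / 2))

end CircleHeat

end

/-!
**Reduction to the line.** Fundamental solutions on the circle are unique for `t > 0` by the maximum
principle (`heat_nonpos`, `IsFundamentalSolution.unique`), so the kernel may be taken to be the
Fourier series `circleKernel`, which also proves existence
(`isFundamentalSolution_circleKernel`). Poisson summation
identifies it with the periodization of the Gaussian `G_t = lineKernel t`, and for `|x - y| ≤ π` all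
terms of the periodization except `G_t(x - y)` are `O(t^P)` for every `P`
(`exists_abs_circleKernel_sub_lineKernel_le`).

**Interior terms.** Extend `ρ` to a `C^M` function `r` on the line with bounded `M`-th derivative.
Then `∫_{[0, π]} G_t(x - y) r(y) dy` is the integral over the line minus the integrals over the two
half-lines outside `[0, π]`. The integral over the line is `∑ tⁿ/n! r^(2n)(x)` up to an error that
is uniform in `x` (`exists_norm_integral_lineKernel_sub_le`); paired with `φ` it gives the interior
coefficients.

**Boundary terms.** At the endpoint `0`, expand `r(-v)` in powers of `v` and `φ(x)` in powers
`x^{k-α}`. The substitution `x = √t u`, `v = √t ũ` evaluates each resulting double integral of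
`G_t(x + v) x^{k-α} v^l` over the quadrant exactly (`integral_cpow_mul_boundaryLayer`), with value
`± c k l α t^{(1+k+l-α)/2}`. All errors are controlled by one estimate: `x^P v^q ≤ (x + v)^{P+q}`,
and the Gaussian moments of order `P + q` are of size `√t ^ (P + q)`
(`pow_mul_norm_integral_lineKernel_le`). The endpoint `π` follows by the reflection `x ↦ π - x`.
-/

namespace CircleHeat

open MeasureTheory

/-! ### Maximum principle and uniqueness of the heat kernel -/

theorem deriv_deriv_nonpos_of_isLocalMax {f : ℝ → ℝ} {x : ℝ} (hf : ContinuousAt f x)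
    (hmax : IsLocalMax f x) : deriv (deriv f) x ≤ 0 := by
  by_contra! hpos
  have hmin := isLocalMin_of_deriv_deriv_pos hpos hmax.deriv_eq_zero hf
  have hconst : f =ᶠ[𝓝 x] fun _ => f x := by
    filter_upwards [hmax, hmin] with y h₁ h₂ using le_antisymm h₁ h₂
  have : deriv (deriv f) x = 0 := by
    rw [hconst.deriv.deriv_eq]
    simp
  exact hpos.ne' this

/-- Only comparison with earlier times is needed, so the maximum may sit at the final time. -/
theorem deriv_nonneg_of_le_left {f : ℝ → ℝ} {a t : ℝ} (hf : DifferentiableAt ℝ f t) (hat : a < t)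
    (hmax : ∀ s ∈ Set.Ioc a t, f s ≤ f t) : 0 ≤ deriv f t := by
  have h := hf.hasDerivAt.hasDerivWithinAt (s := Set.Iio t)
  rw [hasDerivWithinAt_iff_tendsto_slope' (by simp)] at h
  refine ge_of_tendsto h ?_
  filter_upwards [Ioo_mem_nhdsLT hat] with s hs
  rw [slope_def_field]
  exact div_nonneg_of_nonpos (sub_nonpos.2 (hmax s ⟨hs.1, hs.2.le⟩)) (sub_nonpos.2 hs.2.le)

/-- Maximum principle on the circle: a solution `w` of the heat equation with vanishing initial
values is nonpositive. If not, `w - ε t`, extended by `0` to `t = 0`, has a positive maximum over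
`[0, t]` for small `ε > 0`; there `∂ₜ w ≥ ε` and `∂ₓ² w ≤ 0`, against the equation. -/
theorem heat_nonpos {w : S1 → ℝ → ℝ}
    (hc : ContinuousOn (fun p : S1 × ℝ => w p.1 p.2) {p | 0 < p.2})
    (hdt : ∀ (x : S1) (t : ℝ), 0 < t → DifferentiableAt ℝ (w x) t)
    (heq : ∀ (x t : ℝ), 0 < t →
      deriv (w (x : S1)) t + opD (fun y : ℝ => w (y : S1) t) x = 0)
    (hinit : ∀ x : S1,
      Filter.Tendsto (fun p : S1 × ℝ => w p.1 p.2) (𝓝 x ×ˢ 𝓝[>] (0 : ℝ)) (𝓝 0))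
    (x : S1) {t : ℝ} (ht : 0 < t) : w x t ≤ 0 := by
  by_contra! hpos
  obtain ⟨ε, hε, hεt⟩ : ∃ ε : ℝ, 0 < ε ∧ 0 < w x t - ε * t := by
    refine ⟨w x t / (2 * t), by positivity, ?_⟩
    have : w x t / (2 * t) * t = w x t / 2 := by field_simp
    linarith
  set g : S1 × ℝ → ℝ := fun p => if 0 < p.2 then w p.1 p.2 - ε * p.2 else 0 with hg
  have hgc : ContinuousOn g (Set.univ ×ˢ Set.Icc 0 t) := by
    rintro ⟨y, s⟩ ⟨-, hs⟩
    rcases hs.1.eq_or_lt with h0 | h0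
    · simp only at h0
      subst h0
      have : ContinuousAt g (y, 0) := by
        have hg0 : g (y, 0) = 0 := by simp [hg]
        rw [ContinuousAt, hg0]
        refine Filter.Tendsto.if ?_ tendsto_const_nhds
        have h1 : 𝓝 (y, (0 : ℝ)) ⊓ Filter.principal {p : S1 × ℝ | 0 < p.2}
            = 𝓝 y ×ˢ 𝓝[>] (0 : ℝ) := by
          have : {p : S1 × ℝ | 0 < p.2} = Set.univ ×ˢ Set.Ioi 0 := by ext; simp
          rw [this, ← nhdsWithin, nhdsWithin_prod_eq, nhdsWithin_univ]
        have h2 : Filter.Tendsto (fun p : S1 × ℝ => ε * p.2) (𝓝 y ×ˢ 𝓝[>] (0 : ℝ)) (𝓝 0) := by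
          have : Filter.Tendsto (fun p : S1 × ℝ => ε * p.2) (𝓝 (y, (0 : ℝ))) (𝓝 (ε * 0)) :=
            (continuous_const.mul continuous_snd).tendsto (y, (0 : ℝ))
          rw [mul_zero] at this
          refine this.mono_left ?_
          rw [← h1]
          exact inf_le_left
        rw [h1]
        simpa using (hinit y).sub h2
      exact this.continuousWithinAt
    · have hopen : {p : S1 × ℝ | 0 < p.2} ∈ 𝓝 (y, s) :=
        (isOpen_lt continuous_const continuous_snd).mem_nhds h0
      have h1 : ContinuousAt (fun p : S1 × ℝ => w p.1 p.2 - ε * p.2) (y, s) :=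
        (hc.continuousAt hopen).sub (by fun_prop)
      refine (h1.congr ?_).continuousWithinAt
      filter_upwards [hopen] with p hp
      have hp' : 0 < p.2 := hp
      simp [hg, hp']
  obtain ⟨⟨y, s⟩, hys, hmax⟩ := (isCompact_univ.prod isCompact_Icc).exists_isMaxOn
    ⟨(x, t), by simp [ht.le]⟩ hgc
  have hmax' : ∀ (y' : S1) (s' : ℝ), 0 < s' → s' ≤ t → w y' s' - ε * s' ≤ g (y, s) := by
    intro y' s' h1 h2
    have := hmax (show (y', s') ∈ Set.univ ×ˢ Set.Icc 0 t from ⟨trivial, h1.le, h2⟩)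
    simpa [hg, h1] using this
  have hgpos : 0 < g (y, s) := hεt.trans_le (hmax' x t ht le_rfl)
  have hs : 0 < s := by
    by_contra h
    simp [hg, h] at hgpos
  have hgs : g (y, s) = w y s - ε * s := by simp [hg, hs]
  rw [hgs] at hmax'
  obtain ⟨z, rfl⟩ := QuotientAddGroup.mk_surjective y
  change ∀ (y' : S1) (s' : ℝ), 0 < s' → s' ≤ t → w y' s' - ε * s' ≤ w (z : S1) s - ε * s at hmax'
  have h1 : deriv (deriv (fun y : ℝ => w (y : S1) s)) z ≤ 0 := by
    refine deriv_deriv_nonpos_of_isLocalMax ?_ ?_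
    · have h2 : ContinuousAt (fun p : S1 × ℝ => w p.1 p.2) ((z : S1), s) :=
        hc.continuousAt ((isOpen_lt continuous_const continuous_snd).mem_nhds hs)
      have h3 : ContinuousAt (fun y : ℝ => ((y : S1), s)) z := by
        have : Continuous (fun y : ℝ => (y : S1)) := AddCircle.continuous_mk' _
        fun_prop
      exact ContinuousAt.comp (f := fun y : ℝ => ((y : S1), s)) h2 h3
    · refine Filter.Eventually.of_forall fun y' => ?_
      have := hmax' y' s hs hys.2.2
      simpa using this
  have h2 : 0 ≤ deriv (w (z : S1)) s - ε := by
    have h3 : DifferentiableAt ℝ (fun s' => w (z : S1) s' - ε * s') s :=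
      (hdt _ _ hs).sub (by fun_prop)
    have h4 := deriv_nonneg_of_le_left h3 hs fun s' hs' =>
      hmax' z s' hs'.1 (hs'.2.trans hys.2.2)
    rw [deriv_fun_sub (hdt _ _ hs) (by fun_prop)] at h4
    simpa [deriv_const_mul] using h4
  have h3 := heq z s hs
  simp only [opD] at h3
  linarith

theorem continuousOn_integral_kernel {K : S1 → S1 → ℝ → ℝ} (hK : IsFundamentalSolution K)
    (f : C(S1, ℝ)) :
    ContinuousOn (fun p : S1 × ℝ => ∫ y : S1, K p.1 y p.2 * f y) {p | 0 < p.2} := by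
  have := continuousOn_integral_of_compact_support (μ := (volume : Measure S1))
    (f := fun (p : S1 × ℝ) (y : S1) => K p.1 y p.2 * f y) (s := {p | 0 < p.2}) (k := Set.univ)
    isCompact_univ ?_ (by simp)
  · exact this
  · refine ContinuousOn.mul ?_ (by fun_prop)
    exact hK.continuousOn.comp (f := fun q : (S1 × ℝ) × S1 => (q.1.1, q.2, q.1.2))
      (by fun_prop) (fun q hq => hq.1)

/-- The maximum principle applied to the difference of the solutions given by two kernels. -/
theorem integral_kernel_le {K K' : S1 → S1 → ℝ → ℝ} (hK : IsFundamentalSolution K)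
    (hK' : IsFundamentalSolution K') (f : C(S1, ℝ)) (x : S1) {t : ℝ} (ht : 0 < t) :
    ∫ y : S1, K x y t * f y ≤ ∫ y : S1, K' x y t * f y := by
  have h := hK.solves f
  have h' := hK'.solves f
  rw [← sub_nonpos]
  refine heat_nonpos (w := fun x t => (∫ y : S1, K x y t * f y) - ∫ y : S1, K' x y t * f y)
    ?_ ?_ ?_ ?_ x ht
  · exact (continuousOn_integral_kernel hK f).sub (continuousOn_integral_kernel hK' f)
  · exact fun x t ht => (h.differentiable_time x t ht).sub (h'.differentiable_time x t ht)
  · intro x t ht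
    have e := h.heat_equation x t ht
    have e' := h'.heat_equation x t ht
    have c := h.contDiff_space t ht
    have c' := h'.contDiff_space t ht
    rw [deriv_fun_sub (h.differentiable_time x t ht) (h'.differentiable_time x t ht)]
    simp only [opD] at *
    have : deriv (fun y : ℝ => (∫ z : S1, K y z t * f z) - ∫ z : S1, K' y z t * f z)
        = fun y => deriv (fun y : ℝ => (∫ z : S1, K y z t * f z)) y
          - deriv (fun y : ℝ => (∫ z : S1, K' y z t * f z)) y := by
      ext y
      exact deriv_fun_sub (c.differentiable (by norm_num) y) (c'.differentiable (by norm_num) y)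
    rw [this, deriv_fun_sub]
    · linarith
    · exact (contDiff_succ_iff_deriv (n := 1).1 c).2.2.differentiable (by norm_num) x
    · exact (contDiff_succ_iff_deriv (n := 1).1 c').2.2.differentiable (by norm_num) x
  · intro x
    simpa using (h.initial_condition x).sub (h'.initial_condition x)

/-- Two fundamental solutions agree for `t > 0`: integrating them against the continuous function
`K x · t - K' x · t` gives the same value, so that function has vanishing square integral. -/
theorem IsFundamentalSolution.unique {K K' : S1 → S1 → ℝ → ℝ} (hK : IsFundamentalSolution K)
    (hK' : IsFundamentalSolution K') (x y : S1) {t : ℝ} (ht : 0 < t) : K x y t = K' x y t := by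
  have hcont : ∀ {K : S1 → S1 → ℝ → ℝ}, IsFundamentalSolution K → Continuous fun y => K x y t := by
    intro K hK
    rw [← continuousOn_univ]
    exact hK.continuousOn.comp (f := fun y : S1 => (x, y, t)) (by fun_prop) fun _ _ => ht
  let f : C(S1, ℝ) := ⟨fun y => K x y t - K' x y t, (hcont hK).sub (hcont hK')⟩
  have h1 : ∫ y : S1, K x y t * f y = ∫ y : S1, K' x y t * f y :=
    le_antisymm (integral_kernel_le hK hK' f x ht) (integral_kernel_le hK' hK f x ht)
  have hint : ∀ {g : S1 → ℝ}, Continuous g → Integrable g := fun hg =>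
    hg.integrable_of_hasCompactSupport (HasCompactSupport.of_compactSpace _)
  have h2 : ∫ y : S1, f y ^ 2 = 0 := by
    have e := integral_sub (f := fun y => K x y t * f y)
      (g := fun y => K' x y t * f y) (hint ((hcont hK).mul f.continuous))
      (hint ((hcont hK').mul f.continuous))
    rw [h1, sub_self] at e
    rw [← e]
    refine integral_congr_ae (Filter.Eventually.of_forall fun y => ?_)
    simp only [f, ContinuousMap.coe_mk]
    ring
  have hc2 : Continuous fun y => f y ^ 2 := by fun_prop
  rw [integral_eq_zero_iff_of_nonneg (fun y => sq_nonneg _) (hint hc2),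
    hc2.ae_eq_iff_eq volume continuous_zero] at h2
  have h3 := congrFun h2 y
  have h4 : f y = 0 := by simpa using h3
  exact sub_eq_zero.1 h4

/-! ### The heat kernel of the circle as a Fourier series -/

/-- `∑ₙ (in)^p Cₙ e^{inx - n²t}`, the `p`-th space derivative of the Fourier series of a solution
of the heat equation. -/
noncomputable def heatSeries (C : ℤ → ℂ) (p : ℕ) (x t : ℝ) : ℂ :=
  ∑' n : ℤ, (Complex.I * n) ^ p * C n * Complex.exp (Complex.I * n * x - n ^ 2 * t)

theorem summable_abs_pow_mul_exp_neg_sq (p : ℕ) {t : ℝ} (ht : 0 < t) :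
    Summable fun n : ℤ => |(n : ℝ)| ^ p * Real.exp (-(n : ℝ) ^ 2 * t) := by
  have h : Summable fun n : ℕ => |(n : ℝ)| ^ p * Real.exp (-(n : ℝ) ^ 2 * t) := by
    refine (Real.summable_pow_mul_exp_neg_nat_mul p ht).of_nonneg_of_le
      (fun n => by positivity) fun n => ?_
    rw [Nat.abs_cast]
    gcongr _ * Real.exp ?_
    have : (n : ℝ) ≤ (n : ℝ) ^ 2 := by exact_mod_cast Nat.le_self_pow two_ne_zero n
    nlinarith
  refine Summable.of_nat_of_neg (by simpa using h) (by simpa using h)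

theorem norm_exp_heat (n : ℤ) (x t : ℝ) :
    ‖Complex.exp (Complex.I * n * x - n ^ 2 * t)‖ = Real.exp (-(n : ℝ) ^ 2 * t) := by
  rw [Complex.norm_exp]
  congr 1
  have : Complex.I * n * x - n ^ 2 * t
      = ((-(n : ℝ) ^ 2 * t : ℝ) : ℂ) + ((n * x : ℝ) : ℂ) * Complex.I := by push_cast; ring
  rw [this]
  simp [-Complex.ofReal_mul, -Complex.ofReal_neg]

theorem norm_heatSeries_term_le {C : ℤ → ℂ} {M : ℝ} (hC : ∀ n, ‖C n‖ ≤ M) (p : ℕ) (n : ℤ)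
    (x t : ℝ) : ‖(Complex.I * n) ^ p * C n * Complex.exp (Complex.I * n * x - n ^ 2 * t)‖
      ≤ M * (|(n : ℝ)| ^ p * Real.exp (-(n : ℝ) ^ 2 * t)) := by
  rw [norm_mul, norm_exp_heat, norm_mul, norm_pow, norm_mul, Complex.norm_I, one_mul,
    Complex.norm_intCast]
  calc |(n : ℝ)| ^ p * ‖C n‖ * Real.exp (-(n : ℝ) ^ 2 * t)
      ≤ |(n : ℝ)| ^ p * M * Real.exp (-(n : ℝ) ^ 2 * t) := by gcongr; exact hC n
    _ = _ := by ring

theorem summable_heatSeries {C : ℤ → ℂ} {M : ℝ} (hC : ∀ n, ‖C n‖ ≤ M) (p : ℕ) (x : ℝ) {t : ℝ}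
    (ht : 0 < t) : Summable fun n : ℤ =>
      (Complex.I * n) ^ p * C n * Complex.exp (Complex.I * n * x - n ^ 2 * t) :=
  ((summable_abs_pow_mul_exp_neg_sq p ht).mul_left M).of_norm_bounded
    fun n => norm_heatSeries_term_le hC p n x t

theorem hasDerivAt_heatSeries_space {C : ℤ → ℂ} {M : ℝ} (hC : ∀ n, ‖C n‖ ≤ M) (p : ℕ) (x : ℝ)
    {t : ℝ} (ht : 0 < t) :
    HasDerivAt (fun y => heatSeries C p y t) (heatSeries C (p + 1) x t) x := by
  refine hasDerivAt_tsum (y₀ := x) ((summable_abs_pow_mul_exp_neg_sq (p + 1) ht).mul_left M)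
    (fun n y => ?_) (fun n y => norm_heatSeries_term_le hC (p + 1) n y t)
    (summable_heatSeries hC p x ht) x
  have h1 : HasDerivAt (fun y : ℝ => Complex.I * n * (y : ℂ) - n ^ 2 * t) (Complex.I * n * 1) y :=
    (((hasDerivAt_id y).ofReal_comp).const_mul _).sub_const _
  refine (h1.cexp.const_mul ((Complex.I * n) ^ p * C n)).congr_deriv ?_
  ring

theorem hasDerivAt_heatSeries_time {C : ℤ → ℂ} {M : ℝ} (hC : ∀ n, ‖C n‖ ≤ M) (p : ℕ) (x : ℝ)
    {t : ℝ} (ht : 0 < t) :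
    HasDerivAt (fun s => heatSeries C p x s) (heatSeries C (p + 2) x t) t := by
  have hM : 0 ≤ M := (norm_nonneg _).trans (hC 0)
  have ht2 : t ∈ Set.Ioi (t / 2) := by simp [ht]
  refine hasDerivAt_tsum_of_isPreconnected (y₀ := t) (t := Set.Ioi (t / 2))
    (g := fun (n : ℤ) (s : ℝ) =>
      (Complex.I * n) ^ p * C n * Complex.exp (Complex.I * n * x - n ^ 2 * s))
    (g' := fun (n : ℤ) (s : ℝ) =>
      (Complex.I * n) ^ (p + 2) * C n * Complex.exp (Complex.I * n * x - n ^ 2 * s))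
    ((summable_abs_pow_mul_exp_neg_sq (p + 2) (half_pos ht)).mul_left M) isOpen_Ioi
    isPreconnected_Ioi (fun n s _ => ?_) (fun n s hs => ?_) ht2
    (summable_heatSeries hC p x ht) ht2
  · have h1 : HasDerivAt (fun s : ℝ => Complex.I * n * x - n ^ 2 * (s : ℂ)) (-(n ^ 2 * 1)) s :=
      (((hasDerivAt_id s).ofReal_comp).const_mul _).const_sub _
    refine (h1.cexp.const_mul ((Complex.I * n) ^ p * C n)).congr_deriv ?_
    rw [pow_add, mul_pow _ _ 2, Complex.I_sq]
    ring
  · refine (norm_heatSeries_term_le hC (p + 2) n x s).trans ?_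
    gcongr M * (_ * Real.exp ?_)
    have : t / 2 ≤ s := le_of_lt hs
    nlinarith [sq_nonneg (n : ℝ)]

/-- The heat kernel of the circle, `(2π)⁻¹ ∑ₙ e^{-n²t} cos (n(x - y))`. -/
noncomputable def circleKernel (x y : S1) (t : ℝ) : ℝ :=
  1 / (2 * π) * ∑' n : ℤ, Real.exp (-(n : ℝ) ^ 2 * t) * (fourier n (x - y)).re

theorem norm_circleKernel_term_le (n : ℤ) (x : S1) (t : ℝ) :
    ‖Real.exp (-(n : ℝ) ^ 2 * t) * (fourier n x).re‖ ≤ Real.exp (-(n : ℝ) ^ 2 * t) := by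
  rw [norm_mul, Real.norm_of_nonneg (Real.exp_pos _).le]
  refine mul_le_of_le_one_right (Real.exp_pos _).le ?_
  refine (Complex.abs_re_le_norm _).trans (le_of_eq ?_)
  rw [fourier_apply, Circle.norm_coe]

theorem summable_exp_neg_sq {t : ℝ} (ht : 0 < t) :
    Summable fun n : ℤ => Real.exp (-(n : ℝ) ^ 2 * t) := by
  simpa using summable_abs_pow_mul_exp_neg_sq 0 ht

theorem continuousOn_circleKernel :
    ContinuousOn (fun p : S1 × S1 × ℝ => circleKernel p.1 p.2.1 p.2.2) {p | 0 < p.2.2} := by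
  intro q hq
  have hq' : 0 < q.2.2 := hq
  have h : ContinuousOn (fun p : S1 × S1 × ℝ => ∑' n : ℤ,
      Real.exp (-(n : ℝ) ^ 2 * p.2.2) * (fourier n (p.1 - p.2.1)).re) {p | q.2.2 / 2 < p.2.2} := by
    refine continuousOn_tsum (u := fun n : ℤ => Real.exp (-(n : ℝ) ^ 2 * (q.2.2 / 2)))
      (fun n => ?_) (summable_exp_neg_sq (half_pos hq')) fun n p hp => ?_
    · refine Continuous.continuousOn (Continuous.mul (by fun_prop) ?_)
      exact Complex.continuous_re.comp ((fourier n).continuous.comp (by fun_prop))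
    · refine (norm_circleKernel_term_le n _ _).trans ?_
      have hp' : q.2.2 / 2 < p.2.2 := hp
      gcongr Real.exp ?_
      nlinarith [sq_nonneg (n : ℝ)]
  have hopen : {p : S1 × S1 × ℝ | q.2.2 / 2 < p.2.2} ∈ 𝓝 q :=
    (isOpen_lt continuous_const (by fun_prop)).mem_nhds (half_lt_self hq')
  exact ((h.continuousAt hopen).const_mul (1 / (2 * π))).continuousWithinAt

theorem fourier_two_pi (n : ℤ) (x : ℝ) :
    fourier n (x : S1) = Complex.exp (Complex.I * n * x) := by
  rw [fourier_coe_apply]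
  congr 1
  have : (π : ℂ) ≠ 0 := by exact_mod_cast Real.pi_ne_zero
  push_cast
  field_simp

theorem integrable_of_continuous {E : Type*} [NormedAddCommGroup E] {g : S1 → E}
    (hg : Continuous g) : Integrable g :=
  hg.integrable_of_hasCompactSupport (HasCompactSupport.of_compactSpace _)

theorem norm_fourier_integral_le (f : C(S1, ℝ)) (n : ℤ) :
    ‖∫ y : S1, fourier (-n) y * (f y : ℂ)‖ ≤ ∫ y : S1, ‖f y‖ := by
  refine (norm_integral_le_integral_norm _).trans (le_of_eq ?_)
  refine integral_congr_ae (Filter.Eventually.of_forall fun y => ?_)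
  simp only [norm_mul, fourier_apply, Circle.norm_coe, one_mul, Complex.norm_real]

/-- Against `f`, the kernel gives the solution whose Fourier coefficients are those of `f`,
damped by `e^{-n²t}`. -/
theorem integral_circleKernel_mul (f : C(S1, ℝ)) (x : ℝ) {t : ℝ} (ht : 0 < t) :
    ∫ y : S1, circleKernel x y t * f y
      = 1 / (2 * π) * (heatSeries (fun n => ∫ y : S1, fourier (-n) y * (f y : ℂ)) 0 x t).re := by
  have hcont : ∀ n : ℤ, Continuous fun y : S1 =>
      Real.exp (-(n : ℝ) ^ 2 * t) * (fourier n ((x : S1) - y)).re * f y := by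
    intro n
    refine Continuous.mul (continuous_const.mul ?_) f.continuous
    exact Complex.continuous_re.comp ((fourier n).continuous.comp (by fun_prop))
  have hle : ∀ (n : ℤ) (y : S1),
      ‖Real.exp (-(n : ℝ) ^ 2 * t) * (fourier n ((x : S1) - y)).re * f y‖
        ≤ Real.exp (-(n : ℝ) ^ 2 * t) * ‖f y‖ := by
    intro n y
    rw [norm_mul]
    gcongr
    exact norm_circleKernel_term_le n _ t
  have h := hasSum_integral_of_summable_integral_norm
    (F := fun (n : ℤ) (y : S1) =>
      Real.exp (-(n : ℝ) ^ 2 * t) * (fourier n ((x : S1) - y)).re * f y)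
    (μ := (volume : Measure S1)) (fun n => integrable_of_continuous (hcont n)) ?_
  · have e1 : ∀ y : S1, circleKernel x y t * f y = 1 / (2 * π) * ∑' n : ℤ,
        Real.exp (-(n : ℝ) ^ 2 * t) * (fourier n ((x : S1) - y)).re * f y := by
      intro y
      rw [circleKernel, tsum_mul_right, mul_assoc]
    simp_rw [e1]
    rw [integral_const_mul, ← h.tsum_eq, heatSeries, Complex.re_tsum]
    · congr 1
      refine tsum_congr fun n => ?_
      have hi : Integrable fun y : S1 => fourier (-n) y * (f y : ℂ) :=
        integrable_of_continuous (by
          exact (fourier (-n)).continuous.mul (Complex.continuous_ofReal.comp f.continuous))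
      rw [pow_zero, one_mul, mul_comm (∫ y : S1, fourier (-n) y * (f y : ℂ)), ← integral_const_mul]
      change _ = Complex.reCLM _
      rw [← Complex.reCLM.integral_comp_comm (hi.const_mul _)]
      refine integral_congr_ae (Filter.Eventually.of_forall fun y => ?_)
      obtain ⟨y, rfl⟩ := QuotientAddGroup.mk_surjective y
      change Real.exp (-(n : ℝ) ^ 2 * t) * (fourier n ((x : S1) - (y : S1))).re * f (y : S1)
        = (Complex.exp (Complex.I * n * x - n ^ 2 * t) * (fourier (-n) (y : S1) *
            ((f (y : S1) : ℝ) : ℂ))).re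
      have e2 : Complex.exp (Complex.I * n * x - n ^ 2 * t) * (fourier (-n) (y : S1) *
          ((f (y : S1) : ℝ) : ℂ)) = ((Real.exp (-(n : ℝ) ^ 2 * t) : ℝ) : ℂ) *
            fourier n ((x : S1) - (y : S1)) * ((f (y : S1) : ℝ) : ℂ) := by
        rw [← AddCircle.coe_sub, fourier_two_pi, fourier_two_pi, Complex.ofReal_exp, ← mul_assoc,
          ← Complex.exp_add, ← Complex.exp_add]
        congr 2
        push_cast
        ring
      rw [e2, Complex.re_mul_ofReal, Complex.re_ofReal_mul]
    · exact summable_heatSeries (norm_fourier_integral_le f) 0 x ht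
  · refine ((summable_exp_neg_sq ht).mul_right (∫ y : S1, ‖f y‖)).of_nonneg_of_le
      (fun n => by positivity) fun n => ?_
    rw [← integral_const_mul]
    exact integral_mono (integrable_of_continuous (hcont n).norm)
      (integrable_of_continuous (by fun_prop)) fun y => hle n y

theorem hasDerivAt_re_heatSeries_space {C : ℤ → ℂ} {M : ℝ} (hC : ∀ n, ‖C n‖ ≤ M) (p : ℕ) (x : ℝ)
    {t : ℝ} (ht : 0 < t) : HasDerivAt (fun y => 1 / (2 * π) * (heatSeries C p y t).re)
      (1 / (2 * π) * (heatSeries C (p + 1) x t).re) x :=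
  (Complex.reCLM.hasFDerivAt.comp_hasDerivAt x
    (hasDerivAt_heatSeries_space hC p x ht)).const_mul (1 / (2 * π))

theorem hasDerivAt_re_heatSeries_time {C : ℤ → ℂ} {M : ℝ} (hC : ∀ n, ‖C n‖ ≤ M) (p : ℕ) (x : ℝ)
    {t : ℝ} (ht : 0 < t) : HasDerivAt (fun s => 1 / (2 * π) * (heatSeries C p x s).re)
      (1 / (2 * π) * (heatSeries C (p + 2) x t).re) t :=
  (Complex.reCLM.hasFDerivAt.comp_hasDerivAt t
    (hasDerivAt_heatSeries_time hC p x ht)).const_mul (1 / (2 * π))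

theorem hasDerivAt_time_circleKernel (f : C(S1, ℝ)) (x : ℝ) {t : ℝ} (ht : 0 < t) :
    HasDerivAt (fun s => ∫ y : S1, circleKernel x y s * f y)
      (1 / (2 * π) * (heatSeries (fun n => ∫ y : S1, fourier (-n) y * (f y : ℂ)) 2 x t).re) t := by
  refine (hasDerivAt_re_heatSeries_time (norm_fourier_integral_le f) 0 x
    ht).congr_of_eventuallyEq ?_
  filter_upwards [lt_mem_nhds ht] with s hs using integral_circleKernel_mul f x hs

theorem deriv_space_circleKernel (f : C(S1, ℝ)) {t : ℝ} (ht : 0 < t) :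
    deriv (fun x : ℝ => ∫ y : S1, circleKernel x y t * f y) = fun x => 1 / (2 * π) *
      (heatSeries (fun n => ∫ y : S1, fourier (-n) y * (f y : ℂ)) 1 x t).re := by
  simp_rw [integral_circleKernel_mul f _ ht]
  exact funext fun x =>
    (hasDerivAt_re_heatSeries_space (norm_fourier_integral_le f) 0 x ht).deriv

theorem contDiff_re_heatSeries {C : ℤ → ℂ} {M : ℝ} (hC : ∀ n, ‖C n‖ ≤ M) {t : ℝ} (ht : 0 < t)
    (k p : ℕ) : ContDiff ℝ k fun y => 1 / (2 * π) * (heatSeries C p y t).re := by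
  induction k generalizing p with
  | zero =>
    rw [Nat.cast_zero, contDiff_zero]
    exact continuous_iff_continuousAt.2 fun x =>
      (hasDerivAt_re_heatSeries_space hC p x ht).continuousAt
  | succ k ih =>
    rw [Nat.cast_succ, contDiff_succ_iff_deriv]
    refine ⟨fun x => (hasDerivAt_re_heatSeries_space hC p x ht).differentiableAt, by simp, ?_⟩
    rw [show deriv (fun y => 1 / (2 * π) * (heatSeries C p y t).re) =
      fun y => 1 / (2 * π) * (heatSeries C (p + 1) y t).re from funext fun x =>
        (hasDerivAt_re_heatSeries_space hC p x ht).deriv]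
    exact ih (p + 1)

/-! ### Poisson summation and the initial condition -/

/-- The heat kernel of the line, `(4πt)^{-1/2} e^{-z²/4t}`. -/
noncomputable def lineKernel (t z : ℝ) : ℝ := Real.exp (-z ^ 2 / (4 * t)) / √(4 * π * t)

theorem lineKernel_nonneg (t z : ℝ) : 0 ≤ lineKernel t z := by
  unfold lineKernel
  positivity

theorem lineKernel_neg (t z : ℝ) : lineKernel t (-z) = lineKernel t z := by
  simp [lineKernel]

theorem continuous_lineKernel (t : ℝ) : Continuous (lineKernel t) := by
  unfold lineKernel
  fun_prop

/-- Parabolic scaling: `√t G_t(√t w) = G_1(w)`. -/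
theorem lineKernel_scale {t : ℝ} (ht : 0 < t) (w : ℝ) :
    √t * lineKernel t (√t * w) = lineKernel 1 w := by
  have h1 : √t ≠ 0 := (Real.sqrt_pos.2 ht).ne'
  rw [lineKernel, lineKernel, mul_pow, Real.sq_sqrt ht.le, Real.sqrt_mul' _ ht.le, mul_one, mul_one,
    show -(t * w ^ 2) / (4 * t) = -w ^ 2 / 4 by field_simp]
  field_simp

theorem lineKernel_one_eq (w : ℝ) :
    lineKernel 1 w = (√(4 * π))⁻¹ * Real.exp (-(1 / 4) * w ^ 2) := by
  rw [lineKernel, div_eq_mul_inv, mul_comm]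
  congr 2
  · simp
  · ring

theorem integrable_lineKernel_one : Integrable (lineKernel 1) := by
  rw [funext lineKernel_one_eq]
  exact (integrable_exp_neg_mul_sq (by norm_num)).const_mul _

theorem integral_lineKernel_one : ∫ w, lineKernel 1 w = 1 := by
  rw [funext lineKernel_one_eq, integral_const_mul, integral_gaussian]
  rw [show π / (1 / 4) = 4 * π by ring]
  exact inv_mul_cancel₀ (Real.sqrt_pos.2 (by positivity)).ne'

/-- Poisson summation: the Fourier series of the heat kernel of the circle is the periodization
of the heat kernel of the line. -/
theorem circleKernel_eq_tsum_lineKernel (z : ℝ) {t : ℝ} (ht : 0 < t) :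
    circleKernel (z : S1) 0 t = ∑' n : ℤ, lineKernel t (2 * π * n - z) := by
  have hπ : (π : ℂ) ≠ 0 := by exact_mod_cast Real.pi_ne_zero
  have ht' : (t : ℂ) ≠ 0 := by exact_mod_cast ht.ne'
  have hs : ((√(π / t) : ℝ) : ℂ) = 1 / ((t / π : ℝ) : ℂ) ^ (1 / 2 : ℂ) := by
    have h : ((t / π : ℝ) : ℂ) ^ (1 / 2 : ℂ) = ((√(t / π) : ℝ) : ℂ) := by
      rw [Real.sqrt_eq_rpow, Complex.ofReal_cpow (by positivity)]
      norm_num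
    rw [h, ← Complex.ofReal_one, ← Complex.ofReal_div, one_div, ← Real.sqrt_inv, inv_div]
  have hP := Complex.tsum_exp_neg_quadratic (a := ((t / π : ℝ) : ℂ))
    (by rw [Complex.ofReal_re]; positivity) (Complex.I * z / (2 * π))
  rw [← hs] at hP
  have h1 : ∀ n : ℤ, Complex.exp (-π * ((t / π : ℝ) : ℂ) * n ^ 2
      + 2 * π * (Complex.I * z / (2 * π)) * n)
      = ((Real.exp (-(n : ℝ) ^ 2 * t) : ℝ) : ℂ) * fourier n (z : S1) := by
    intro n
    rw [fourier_two_pi, Complex.ofReal_exp, ← Complex.exp_add]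
    congr 1
    push_cast
    field_simp
  have h2 : ∀ n : ℤ, Complex.exp (-π / ((t / π : ℝ) : ℂ) *
      (n + Complex.I * (Complex.I * z / (2 * π))) ^ 2)
      = ((Real.exp (-(2 * π * n - z) ^ 2 / (4 * t)) : ℝ) : ℂ) := by
    intro n
    rw [Complex.ofReal_exp]
    congr 1
    rw [← mul_div_assoc, ← mul_assoc, Complex.I_mul_I]
    push_cast
    field_simp
    ring
  simp_rw [h1, h2] at hP
  rw [← Complex.ofReal_tsum, ← Complex.ofReal_mul] at hP
  have h3 : ∑' n : ℤ, Real.exp (-(n : ℝ) ^ 2 * t) * (fourier n ((z : S1) - 0)).re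
      = √(π / t) * ∑' n : ℤ, Real.exp (-(2 * π * n - z) ^ 2 / (4 * t)) := by
    rw [← Complex.ofReal_re (√(π / t) * _), ← hP, Complex.re_tsum]
    · refine tsum_congr fun n => ?_
      rw [Complex.re_ofReal_mul, sub_zero]
    · refine (summable_exp_neg_sq ht).of_norm_bounded fun n => ?_
      rw [norm_mul, fourier_apply, Circle.norm_coe, mul_one, Complex.norm_real,
        Real.norm_of_nonneg (Real.exp_pos _).le]
  rw [circleKernel, h3, ← mul_assoc, ← tsum_mul_left]
  refine tsum_congr fun n => ?_
  rw [lineKernel, div_eq_mul_inv _ (√(4 * π * t)), mul_comm]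
  congr 1
  rw [show π / t = (4 * π * t) * (1 / (2 * t)) ^ 2 by field_simp; norm_num,
    Real.sqrt_mul (by positivity), Real.sqrt_sq (by positivity)]
  have h6 : √(4 * π * t) ≠ 0 := (Real.sqrt_pos.2 (by positivity)).ne'
  have h7 := Real.pi_ne_zero
  field_simp
  rw [Real.sq_sqrt (by positivity)]
  ring

/-- Off the diagonal the heat kernel of the line is smaller than every power of `t`. -/
theorem lineKernel_le_pow (P : ℕ) {t w : ℝ} (ht : 0 < t) (ht1 : t ≤ 1) (hw : w ≠ 0) :
    lineKernel t w ≤ ((P + 1).factorial * 4 ^ (P + 1)) * t ^ P * (w ^ 2)⁻¹ ^ (P + 1) := by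
  have hw2 : 0 < w ^ 2 := by positivity
  set s := w ^ 2 / (4 * t) with hs
  have hs0 : 0 < s := by positivity
  have h1 : Real.exp (-w ^ 2 / (4 * t)) ≤ (P + 1).factorial * (s⁻¹) ^ (P + 1) := by
    have := Real.pow_div_factorial_le_exp s hs0.le (P + 1)
    rw [neg_div, ← hs, Real.exp_neg, inv_pow]
    rw [inv_le_comm₀ (Real.exp_pos _) (by positivity), mul_inv, inv_inv]
    calc _ = s ^ (P + 1) / (P + 1).factorial := by rw [mul_comm]; rfl
      _ ≤ _ := this
  have h2 : √t * 1 ≤ √(4 * π * t) * 1 := by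
    gcongr
    nlinarith [Real.pi_gt_three]
  have h3 : 0 < √t := Real.sqrt_pos.2 ht
  have h4 : t ≤ √t := Real.le_sqrt_of_sq_le (by nlinarith)
  rw [lineKernel, div_le_iff₀ (by linarith)]
  calc _ ≤ (P + 1).factorial * (s⁻¹) ^ (P + 1) := h1
    _ = ((P + 1).factorial * 4 ^ (P + 1)) * t ^ P * (w ^ 2)⁻¹ ^ (P + 1) * t := by
      rw [hs, inv_div, div_eq_mul_inv, mul_pow, mul_pow]
      ring
    _ ≤ _ := by
      gcongr
      linarith

/-- For `|z| ≤ π` the heat kernels of the circle and of the line agree to every order in `t`. -/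
theorem exists_abs_circleKernel_sub_lineKernel_le (P : ℕ) :
    ∃ C : ℝ, 0 ≤ C ∧ ∀ t : ℝ, 0 < t → t ≤ 1 → ∀ z : ℝ, |z| ≤ π →
      |circleKernel (z : S1) 0 t - lineKernel t z| ≤ C * t ^ P := by
  set A : ℝ := (P + 1).factorial * 4 ^ (P + 1) with hA
  have hsum : Summable fun n : ℤ => 1 / (n : ℝ) ^ (2 * (P + 1)) :=
    Real.summable_one_div_int_pow.2 (by omega)
  refine ⟨A * ∑' n : ℤ, 1 / (n : ℝ) ^ (2 * (P + 1)),
    mul_nonneg (by positivity) (tsum_nonneg fun n => ?_), ?_⟩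
  · rw [pow_mul]; positivity
  intro t ht ht1 z hz
  -- For `n ≠ 0` the argument is at least `2π|n| - π ≥ |n|` in absolute value.
  have hle : ∀ n : ℤ, n ≠ 0 →
      lineKernel t (2 * π * n - z) ≤ A * t ^ P * (1 / (n : ℝ) ^ (2 * (P + 1))) := by
    intro n hn
    have hn1 : (1 : ℝ) ≤ |(n : ℝ)| := by exact_mod_cast Int.one_le_abs hn
    have h1 : |(n : ℝ)| ≤ |2 * π * n - z| := by
      have := abs_sub_abs_le_abs_sub (2 * π * n) z
      rw [abs_mul, abs_of_pos Real.two_pi_pos] at this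
      nlinarith [Real.pi_gt_three]
    have h2 : (n : ℝ) ^ 2 ≤ (2 * π * n - z) ^ 2 := sq_le_sq.2 h1
    have hn2 : 0 < (n : ℝ) ^ 2 := by positivity
    refine (lineKernel_le_pow P ht ht1 (w := 2 * π * n - z) ?_).trans ?_
    · rw [← abs_pos]; linarith
    · rw [← hA, one_div, pow_mul, ← inv_pow ((n : ℝ) ^ 2)]
      gcongr
  have hs0 : Summable fun n : ℤ => lineKernel t (2 * π * n - z) := by
    refine Summable.of_norm_bounded_eventually (hsum.mul_left (A * t ^ P)) ?_
    rw [Filter.eventually_cofinite]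
    refine (Set.finite_singleton (0 : ℤ)).subset fun n hn => ?_
    by_contra h
    refine hn ?_
    rw [Real.norm_of_nonneg (lineKernel_nonneg _ _)]
    exact hle n h
  rw [circleKernel_eq_tsum_lineKernel z ht, hs0.tsum_eq_add_tsum_ite 0]
  have h0 : lineKernel t (2 * π * (0 : ℤ) - z) = lineKernel t z := by
    rw [← lineKernel_neg]; simp
  rw [h0, add_sub_cancel_left, abs_of_nonneg (tsum_nonneg fun n => by
    split_ifs
    exacts [le_rfl, lineKernel_nonneg _ _])]
  have hle' : ∀ n : ℤ, (if n = 0 then 0 else lineKernel t (2 * π * n - z))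
      ≤ A * t ^ P * (1 / (n : ℝ) ^ (2 * (P + 1))) := by
    intro n
    split_ifs with h
    · rw [pow_mul]; positivity
    · exact hle n h
  calc _ ≤ ∑' n : ℤ, A * t ^ P * (1 / (n : ℝ) ^ (2 * (P + 1))) := by
        refine Summable.tsum_le_tsum hle' ?_ (hsum.mul_left _)
        refine (hsum.mul_left _).of_nonneg_of_le (fun n => ?_) hle'
        split_ifs
        exacts [le_rfl, lineKernel_nonneg _ _]
    _ = _ := by rw [tsum_mul_left]; ring

theorem circleKernel_sub (x z : S1) (t : ℝ) : circleKernel x (x - z) t = circleKernel z 0 t := by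
  simp [circleKernel]

theorem integral_circleKernel_eq_intervalIntegral (f : C(S1, ℝ)) (x : S1) (t : ℝ) :
    ∫ y : S1, circleKernel x y t * f y
      = ∫ z in (-π)..π, circleKernel (z : S1) 0 t * f (x - (z : S1)) := by
  rw [← integral_sub_left_eq_self (fun y : S1 => circleKernel x y t * f y) volume x]
  simp_rw [circleKernel_sub]
  rw [← AddCircle.intervalIntegral_preimage (2 * π) (-π)]
  congr 1
  ring

/-- After the substitution `z = √t w` this is dominated convergence, jointly in the base point
and in time. -/
theorem tendsto_integral_lineKernel (f : C(S1, ℝ)) (x₀ : S1) :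
    Filter.Tendsto (fun p : S1 × ℝ => ∫ z in (-π)..π, lineKernel p.2 z * f (p.1 - (z : S1)))
      (𝓝 x₀ ×ˢ 𝓝[>] (0 : ℝ)) (𝓝 (f x₀)) := by
  have hcoe : Continuous fun y : ℝ => (y : S1) := AddCircle.continuous_mk' _
  have h0 : ∀ᶠ p : S1 × ℝ in 𝓝 x₀ ×ˢ 𝓝[>] (0 : ℝ), 0 < p.2 :=
    Filter.tendsto_snd.eventually self_mem_nhdsWithin
  have key : Filter.Tendsto (fun p : S1 × ℝ => ∫ w : ℝ, (Set.Ioc (-π / √p.2) (π / √p.2)).indicator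
      (fun w => lineKernel 1 w * f (p.1 - ((√p.2 * w : ℝ) : S1))) w)
      (𝓝 x₀ ×ˢ 𝓝[>] (0 : ℝ)) (𝓝 (∫ w : ℝ, lineKernel 1 w * f x₀)) := by
    refine tendsto_integral_filter_of_dominated_convergence (fun w => lineKernel 1 w * ‖f‖)
      (Filter.Eventually.of_forall fun p => ?_) (Filter.Eventually.of_forall fun p => ?_)
      (integrable_lineKernel_one.mul_const _) (Filter.Eventually.of_forall fun w => ?_)
    · refine AEStronglyMeasurable.indicator ?_ measurableSet_Ioc
      exact ((continuous_lineKernel 1).mul (f.continuous.comp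
        (continuous_const.sub (hcoe.comp (by fun_prop))))).aestronglyMeasurable
    · refine Filter.Eventually.of_forall fun w => (norm_indicator_le_norm_self _ _).trans ?_
      rw [norm_mul, Real.norm_of_nonneg (lineKernel_nonneg _ _)]
      exact mul_le_mul_of_nonneg_left (f.norm_coe_le_norm _) (lineKernel_nonneg _ _)
    · have hsq : Filter.Tendsto (fun p : S1 × ℝ => √p.2) (𝓝 x₀ ×ˢ 𝓝[>] (0 : ℝ)) (𝓝[>] 0) := by
        refine tendsto_nhdsWithin_iff.2 ⟨?_, h0.mono fun p hp => Real.sqrt_pos.2 hp⟩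
        have : Filter.Tendsto (fun t : ℝ => √t) (𝓝 0) (𝓝 0) := by
          simpa using Real.continuous_sqrt.tendsto 0
        exact this.comp (Filter.tendsto_snd.mono_right nhdsWithin_le_nhds)
      have hbig : ∀ᶠ p : S1 × ℝ in 𝓝 x₀ ×ˢ 𝓝[>] (0 : ℝ), |w| < π / √p.2 := by
        have : Filter.Tendsto (fun p : S1 × ℝ => π * (√p.2)⁻¹) (𝓝 x₀ ×ˢ 𝓝[>] (0 : ℝ))
            Filter.atTop :=
          (tendsto_inv_nhdsGT_zero.comp hsq).const_mul_atTop Real.pi_pos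
        exact this.eventually_gt_atTop _
      have hlim : Filter.Tendsto
          (fun p : S1 × ℝ => lineKernel 1 w * f (p.1 - ((√p.2 * w : ℝ) : S1)))
          (𝓝 x₀ ×ˢ 𝓝[>] (0 : ℝ)) (𝓝 (lineKernel 1 w * f x₀)) := by
        refine Filter.Tendsto.const_mul _ ?_
        have h1 : Filter.Tendsto (fun p : S1 × ℝ => p.1 - ((√p.2 * w : ℝ) : S1))
            (𝓝 x₀ ×ˢ 𝓝[>] (0 : ℝ)) (𝓝 (x₀ - ((0 * w : ℝ) : S1))) := by
          refine Filter.tendsto_fst.sub ((hcoe.tendsto _).comp ?_)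
          exact (hsq.mono_right nhdsWithin_le_nhds).mul_const w
        rw [zero_mul, AddCircle.coe_zero, sub_zero] at h1
        exact (f.continuous.tendsto x₀).comp h1
      refine hlim.congr' ?_
      filter_upwards [hbig] with p hp
      rw [abs_lt] at hp
      rw [Set.indicator_of_mem]
      exact ⟨by rw [neg_div]; exact hp.1, hp.2.le⟩
  rw [integral_mul_const, integral_lineKernel_one, one_mul] at key
  refine key.congr' ?_
  filter_upwards [h0] with p hp
  have hs : 0 < √p.2 := Real.sqrt_pos.2 hp
  rw [integral_indicator measurableSet_Ioc,
    ← intervalIntegral.integral_of_le (by gcongr; linarith [Real.pi_pos])]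
  have h := intervalIntegral.smul_integral_comp_mul_left (a := -π / √p.2) (b := π / √p.2)
    (fun z => lineKernel p.2 z * f (p.1 - (z : S1))) (√p.2)
  rw [mul_div_cancel₀ _ hs.ne', mul_div_cancel₀ _ hs.ne'] at h
  rw [← h, smul_eq_mul, ← intervalIntegral.integral_const_mul]
  refine intervalIntegral.integral_congr fun w _ => ?_
  simp only [← lineKernel_scale hp]
  ring

theorem tendsto_integral_circleKernel (f : C(S1, ℝ)) (x₀ : S1) :
    Filter.Tendsto (fun p : S1 × ℝ => ∫ y : S1, circleKernel p.1 y p.2 * f y)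
      (𝓝 x₀ ×ˢ 𝓝[>] (0 : ℝ)) (𝓝 (f x₀)) := by
  have hcoe : Continuous fun y : ℝ => (y : S1) := AddCircle.continuous_mk' _
  obtain ⟨C, hC0, hC⟩ := exists_abs_circleKernel_sub_lineKernel_le 1
  rw [← add_zero (f x₀)]
  have hzero : Filter.Tendsto (fun p : S1 × ℝ => ∫ z in (-π)..π,
      (circleKernel (z : S1) 0 p.2 - lineKernel p.2 z) * f (p.1 - (z : S1)))
      (𝓝 x₀ ×ˢ 𝓝[>] (0 : ℝ)) (𝓝 0) := by
    have hev : ∀ᶠ p : S1 × ℝ in 𝓝 x₀ ×ˢ 𝓝[>] (0 : ℝ), p.2 ∈ Set.Ioc (0 : ℝ) 1 :=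
      Filter.tendsto_snd.eventually (Ioc_mem_nhdsGT zero_lt_one)
    have hlim : Filter.Tendsto (fun p : S1 × ℝ => C * p.2 ^ 1 * ‖f‖ * |π - -π|)
        (𝓝 x₀ ×ˢ 𝓝[>] (0 : ℝ)) (𝓝 0) := by
      have : Filter.Tendsto (fun t : ℝ => C * t ^ 1 * ‖f‖ * |π - -π|) (𝓝 0) (𝓝 0) := by
        have h : Continuous fun t : ℝ => C * t ^ 1 * ‖f‖ * |π - -π| := by fun_prop
        simpa using h.tendsto 0
      exact this.comp (Filter.tendsto_snd.mono_right nhdsWithin_le_nhds)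
    refine squeeze_zero_norm' ?_ hlim
    filter_upwards [hev] with p hp
    refine intervalIntegral.norm_integral_le_of_norm_le_const fun z hz => ?_
    rw [Set.uIoc_of_le (by linarith [Real.pi_pos])] at hz
    rw [norm_mul]
    exact mul_le_mul (hC p.2 hp.1 hp.2 z (abs_le.2 ⟨hz.1.le, hz.2⟩)) (f.norm_coe_le_norm _)
      (norm_nonneg _) (mul_nonneg hC0 (pow_nonneg hp.1.le _))
  refine ((tendsto_integral_lineKernel f x₀).add hzero).congr' ?_
  filter_upwards [Filter.tendsto_snd.eventually
    (self_mem_nhdsWithin : Set.Ioi (0 : ℝ) ∈ 𝓝[>] (0 : ℝ))] with p hp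
  have hf : Continuous fun z : ℝ => f (p.1 - (z : S1)) :=
    f.continuous.comp (continuous_const.sub hcoe)
  have hk : Continuous fun z : ℝ => circleKernel (z : S1) 0 p.2 := by
    rw [← continuousOn_univ]
    exact continuousOn_circleKernel.comp (f := fun z : ℝ => ((z : S1), (0 : S1), p.2))
      (by fun_prop) fun _ _ => hp
  have hl := continuous_lineKernel p.2
  rw [integral_circleKernel_eq_intervalIntegral]
  refine (intervalIntegral.integral_add ((hl.mul hf).intervalIntegrable _ _)
    (((hk.sub hl).mul hf).intervalIntegrable _ _)).symm.trans ?_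
  refine intervalIntegral.integral_congr fun z _ => ?_
  simp only [Pi.mul_apply, Pi.sub_apply]
  ring

theorem isFundamentalSolution_circleKernel : IsFundamentalSolution circleKernel where
  continuousOn := continuousOn_circleKernel
  solves f :=
    { differentiable_time := by
        intro x t ht
        obtain ⟨x, rfl⟩ := QuotientAddGroup.mk_surjective x
        exact (hasDerivAt_time_circleKernel f x ht).differentiableAt
      contDiff_space := by
        intro t ht
        simp_rw [integral_circleKernel_mul f _ ht]
        exact contDiff_re_heatSeries (norm_fourier_integral_le f) ht 2 0
      heat_equation := by
        intro x t ht
        rw [opD, deriv_space_circleKernel f ht, (hasDerivAt_time_circleKernel f x ht).deriv,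
          (hasDerivAt_re_heatSeries_space (norm_fourier_integral_le f) 1 x ht).deriv,
          add_neg_cancel]
      initial_condition := tendsto_integral_circleKernel f }

/-! ### Smooth extension and Taylor estimates -/

/-- A `C^n` function on a compact interval extends to a `C^n` function on the line whose `n`-th
derivative is bounded: extend the `n`-th derivative by constants and integrate `n` times. The bound
keeps the extension of polynomial growth and makes Taylor estimates uniform. -/
theorem exists_contDiff_extension {a b : ℝ} (hab : a < b) (n : ℕ) (f : ℝ → ℂ)
    (hf : ContDiffOn ℝ n f (Set.Icc a b)) :
    ∃ g : ℝ → ℂ, ContDiff ℝ n g ∧ Set.EqOn g f (Set.Icc a b) ∧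
      ∃ C : ℝ, ∀ x, ‖iteratedDeriv n g x‖ ≤ C := by
  induction n generalizing f with
  | zero =>
    have hc : ContinuousOn f (Set.Icc a b) := hf.continuousOn
    refine ⟨Set.IccExtend hab.le ((Set.Icc a b).domRestrict f), ?_, ?_, ?_⟩
    · rw [Nat.cast_zero, contDiff_zero]
      exact (continuousOn_iff_continuous_domRestrict.1 hc).Icc_extend'
    · intro x hx
      rw [Set.IccExtend_of_mem _ _ hx, Set.domRestrict_apply]
    · obtain ⟨C, hC⟩ := isCompact_Icc.exists_bound_of_continuousOn hc
      refine ⟨C, fun x => ?_⟩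
      rw [iteratedDeriv_zero]
      exact hC _ (Set.projIcc a b hab.le x).2
  | succ n ih =>
    rw [Nat.cast_succ, contDiffOn_succ_iff_derivWithin (uniqueDiffOn_Icc hab)] at hf
    obtain ⟨hd, -, hf'⟩ := hf
    obtain ⟨g, hg, hgf, C, hC⟩ := ih _ hf'
    have hgd : ∀ x, HasDerivAt (fun x => f a + ∫ s in a..x, g s) (g x) x := fun x =>
      (intervalIntegral.integral_hasDerivAt_right (hg.continuous.intervalIntegrable _ _)
        (hg.continuous.stronglyMeasurableAtFilter _ _) hg.continuous.continuousAt).const_add _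
    have hder : deriv (fun x => f a + ∫ s in a..x, g s) = g := funext fun x => (hgd x).deriv
    refine ⟨fun x => f a + ∫ s in a..x, g s, ?_, ?_, C, ?_⟩
    · rw [Nat.cast_succ, contDiff_succ_iff_deriv, hder]
      exact ⟨fun x => (hgd x).differentiableAt, by simp, hg⟩
    · intro x hx
      have := intervalIntegral.integral_eq_sub_of_hasDeriv_right_of_le (a := a) (b := x) (f := f)
        (f' := g) hx.1 (hd.continuousOn.mono (Set.Icc_subset_Icc_right hx.2)) (fun y hy => ?_)
        (hg.continuous.intervalIntegrable _ _)
      · simp only [this]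
        ring
      · have hy' : y ∈ Set.Icc a b := ⟨hy.1.le, hy.2.le.trans hx.2⟩
        rw [hgf hy']
        exact ((hd y hy').hasDerivWithinAt.hasDerivAt
          (Icc_mem_nhds hy.1 (hy.2.trans_le hx.2))).hasDerivWithinAt
    · intro x
      rw [iteratedDeriv_succ', hder]
      exact hC x

/-- Taylor estimate with base point and evaluation point anywhere on the line. -/
theorem norm_sub_taylor_le {M : ℕ} {g : ℝ → ℂ} {C : ℝ} (hg : ContDiff ℝ M g)
    (hC : ∀ x, ‖iteratedDeriv M g x‖ ≤ C) (x y : ℝ) :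
    ‖g y - ∑ m ∈ Finset.range M, ((y - x) ^ m / (m.factorial : ℝ)) • iteratedDeriv m g x‖
      ≤ C * |y - x| ^ M := by
  have hC0 : 0 ≤ C := (norm_nonneg _).trans (hC 0)
  induction M generalizing g y with
  | zero => simpa using hC y
  | succ M ih =>
    rw [Nat.cast_succ, contDiff_succ_iff_deriv] at hg
    obtain ⟨hd, -, hg'⟩ := hg
    simp_rw [iteratedDeriv_succ'] at hC
    set h : ℝ → ℂ := fun y =>
      g y - ∑ m ∈ Finset.range (M + 1), ((y - x) ^ m / (m.factorial : ℝ)) • iteratedDeriv m g x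
      with hh
    have hderiv : ∀ y, HasDerivAt h (deriv g y - ∑ m ∈ Finset.range M,
        ((y - x) ^ m / (m.factorial : ℝ)) • iteratedDeriv m (deriv g) x) y := by
      intro y
      simp_rw [hh, Finset.sum_range_succ' _ M]
      refine (hd y).hasDerivAt.sub ?_
      simp only [pow_zero]
      refine (HasDerivAt.fun_sum fun m _ => ?_).add_const _
      rw [iteratedDeriv_succ']
      refine HasDerivAt.smul_const ?_ _
      have h1 := ((hasDerivAt_id y).sub_const x).pow (m + 1) |>.div_const ((m + 1).factorial : ℝ)
      refine h1.congr_deriv ?_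
      rw [Nat.factorial_succ]
      have : (m.factorial : ℝ) ≠ 0 := by positivity
      push_cast
      simp only [id]
      field_simp
    have hx : h x = 0 := by
      rw [hh]
      simp only [sub_self, Finset.sum_range_succ', zero_pow (Nat.succ_ne_zero _)]
      simp
    have hmv := (convex_uIcc x y).norm_image_sub_le_of_norm_hasDerivWithin_le (f := h)
      (C := C * |y - x| ^ M) (fun z _ => (hderiv z).hasDerivWithinAt) (fun z hz => ?_)
      Set.left_mem_uIcc Set.right_mem_uIcc
    · rw [hx, sub_zero, Real.norm_eq_abs] at hmv
      rw [pow_succ, ← mul_assoc]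
      exact hmv
    · refine (ih hg' hC z).trans ?_
      exact mul_le_mul_of_nonneg_left
        (pow_le_pow_left₀ (abs_nonneg _) (Set.abs_sub_left_of_mem_uIcc hz) M) hC0

/-! ### Moments of the Gaussian and the heat flow on the line -/

theorem integrable_lineKernel_one_mul_pow (p : ℕ) :
    Integrable fun w => lineKernel 1 w * w ^ p := by
  have h := (integrable_rpow_mul_exp_neg_mul_sq (b := 1 / 4) (by norm_num) (s := p)
    (by have : (0 : ℝ) ≤ p := p.cast_nonneg
        linarith)).const_mul (√(4 * π))⁻¹
  refine h.congr (Filter.Eventually.of_forall fun w => ?_)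
  simp only [Real.rpow_natCast, lineKernel_one_eq]
  ring

theorem integrable_lineKernel_one_mul_abs_pow (p : ℕ) :
    Integrable fun w => lineKernel 1 w * |w| ^ p := by
  refine (integrable_lineKernel_one_mul_pow p).norm.congr (Filter.Eventually.of_forall fun w => ?_)
  simp only [norm_mul, norm_pow, Real.norm_eq_abs, abs_of_nonneg (lineKernel_nonneg _ _)]

theorem integral_lineKernel_one_mul_pow_odd (n : ℕ) :
    ∫ w, lineKernel 1 w * w ^ (2 * n + 1) = 0 := by
  have h := integral_neg_eq_self (fun w => lineKernel 1 w * w ^ (2 * n + 1)) volume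
  simp only [lineKernel_neg, Odd.neg_pow ⟨n, rfl⟩, mul_neg, integral_neg] at h
  linarith

theorem doubleFactorial_mul_two_pow (n : ℕ) :
    ((2 * n - 1).doubleFactorial : ℝ) * 2 ^ n = (2 * n).factorial / n.factorial := by
  have hn : (n.factorial : ℝ) ≠ 0 := by positivity
  rw [eq_div_iff hn]
  cases n with
  | zero => simp
  | succ k =>
    have h1 : 2 * (k + 1) - 1 = 2 * k + 1 := by omega
    have h2 : 2 * (k + 1) = 2 * k + 1 + 1 := by omega
    have h3 := Nat.factorial_eq_mul_doubleFactorial (2 * k + 1)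
    have h4 := Nat.doubleFactorial_two_mul (k + 1)
    rw [← h2, h4] at h3
    rw [h1, h3]
    push_cast
    ring

theorem integral_lineKernel_one_mul_pow_even (n : ℕ) :
    ∫ w, lineKernel 1 w * w ^ (2 * n) = (2 * n).factorial / n.factorial := by
  have h1 : ∫ w, lineKernel 1 w * w ^ (2 * n)
      = (√(4 * π))⁻¹ * ∫ w, |w| ^ (2 * n) * Real.exp (-(1 / 4) * |w| ^ 2) := by
    rw [← integral_const_mul]
    refine integral_congr_ae (Filter.Eventually.of_forall fun w => ?_)
    simp only [lineKernel_one_eq, sq_abs, pow_mul]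
    ring
  have h2 := integral_rpow_mul_exp_neg_mul_rpow (p := 2) (q := (2 * n : ℕ)) (b := 1 / 4)
    (by norm_num) (by have : (0 : ℝ) ≤ (2 * n : ℕ) := Nat.cast_nonneg _
                      linarith) (by norm_num)
  simp only [Real.rpow_natCast, Real.rpow_two] at h2
  have h4 : (4 : ℝ) ^ (1 / 2 : ℝ) = 2 := by
    rw [← Real.sqrt_eq_rpow, show (4 : ℝ) = 2 ^ 2 by norm_num, Real.sqrt_sq (by norm_num)]
  have h5 : √(4 * π) = 2 * √π := by
    rw [Real.sqrt_mul (by norm_num), show (4 : ℝ) = 2 ^ 2 by norm_num, Real.sqrt_sq (by norm_num)]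
  have h6 : (4 : ℝ) ^ n = 2 ^ n * 2 ^ n := by rw [← mul_pow]; norm_num
  rw [h1, integral_comp_abs (f := fun w => w ^ (2 * n) * Real.exp (-(1 / 4) * w ^ 2)), h2,
    show (((2 * n : ℕ) : ℝ) + 1) / 2 = n + 1 / 2 by push_cast; ring, Real.Gamma_nat_add_half,
    show -(((2 * n : ℕ) : ℝ) + 1) / 2 = -(n + 1 / 2 : ℝ) by push_cast; ring,
    ← doubleFactorial_mul_two_pow, one_div, Real.inv_rpow (by norm_num),
    Real.rpow_neg (by norm_num),
    inv_inv, Real.rpow_add (by norm_num), Real.rpow_natCast, h4, h5, h6]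
  have := (Real.sqrt_pos.2 Real.pi_pos).ne'
  field_simp

theorem integral_lineKernel_smul (g : ℝ → ℂ) (x : ℝ) {t : ℝ} (ht : 0 < t) :
    ∫ y, lineKernel t (x - y) • g y = ∫ w, lineKernel 1 w • g (x + √t * w) := by
  have hs : 0 < √t := Real.sqrt_pos.2 ht
  rw [← integral_add_left_eq_self _ x]
  have h := Measure.integral_comp_mul_left (fun z => lineKernel t (x - (x + z)) • g (x + z)) (√t)
  rw [abs_of_pos (inv_pos.2 hs), eq_inv_smul_iff₀ hs.ne'] at h
  rw [← h, ← integral_smul]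
  refine integral_congr_ae (Filter.Eventually.of_forall fun w => ?_)
  simp only
  rw [sub_add_cancel_left, lineKernel_neg, smul_smul, lineKernel_scale ht]

theorem integrable_lineKernel_smul {M : ℕ} {g : ℝ → ℂ} {C : ℝ} (hg : ContDiff ℝ M g)
    (hC : ∀ x, ‖iteratedDeriv M g x‖ ≤ C) (x s : ℝ) :
    Integrable fun w => lineKernel 1 w • g (x + s * w) := by
  have hT : Integrable fun w => lineKernel 1 w • ∑ m ∈ Finset.range M,
      ((s * w) ^ m / (m.factorial : ℝ)) • iteratedDeriv m g x := by
    simp_rw [Finset.smul_sum]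
    refine integrable_finsetSum _ fun m _ => ?_
    refine (((integrable_lineKernel_one_mul_pow m).const_mul (s ^ m / m.factorial)).smul_const
      (iteratedDeriv m g x)).congr (Filter.Eventually.of_forall fun w => ?_)
    simp only [smul_smul]
    congr 1
    rw [mul_pow]
    ring
  have hR : Integrable fun w => lineKernel 1 w • (g (x + s * w) - ∑ m ∈ Finset.range M,
      ((s * w) ^ m / (m.factorial : ℝ)) • iteratedDeriv m g x) := by
    refine ((integrable_lineKernel_one_mul_abs_pow M).const_mul (C * |s| ^ M)).mono' ?_
      (Filter.Eventually.of_forall fun w => ?_)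
    · have := hg.continuous
      have := continuous_lineKernel 1
      exact Continuous.aestronglyMeasurable (by fun_prop)
    · rw [norm_smul, Real.norm_of_nonneg (lineKernel_nonneg _ _)]
      have := norm_sub_taylor_le hg hC x (x + s * w)
      rw [add_sub_cancel_left, abs_mul, mul_pow] at this
      calc _ ≤ lineKernel 1 w * (C * (|s| ^ M * |w| ^ M)) :=
            mul_le_mul_of_nonneg_left this (lineKernel_nonneg _ _)
        _ = _ := by ring
  refine (hT.add hR).congr (Filter.Eventually.of_forall fun w => ?_)
  simp only [Pi.add_apply, ← smul_add, add_sub_cancel]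

theorem integrable_lineKernel_sub_smul {M : ℕ} {g : ℝ → ℂ} {C : ℝ} (hg : ContDiff ℝ M g)
    (hC : ∀ x, ‖iteratedDeriv M g x‖ ≤ C) (x : ℝ) {t : ℝ} (ht : 0 < t) :
    Integrable fun y => lineKernel t (x - y) • g y := by
  have hs : 0 < √t := Real.sqrt_pos.2 ht
  have h := integrable_lineKernel_smul hg hC x √t
  have h2 : Integrable fun z => lineKernel t (x - (x + z)) • g (x + z) := by
    rw [← integrable_comp_mul_left_iff _ hs.ne']
    refine (h.smul (√t)⁻¹).congr (Filter.Eventually.of_forall fun w => ?_)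
    simp only [Pi.smul_apply]
    rw [sub_add_cancel_left, lineKernel_neg, ← lineKernel_scale ht, smul_smul, ← mul_assoc,
      inv_mul_cancel₀ hs.ne', one_mul]
  refine (h2.comp_add_left (-x)).congr (Filter.Eventually.of_forall fun y => ?_)
  simp only [add_neg_cancel_left]

theorem sum_range_two_mul_of_odd_eq_zero {f : ℕ → ℂ} (hf : ∀ n, f (2 * n + 1) = 0) (N : ℕ) :
    ∑ m ∈ Finset.range (2 * N), f m = ∑ n ∈ Finset.range N, f (2 * n) := by
  induction N with
  | zero => simp
  | succ N ih =>
    rw [mul_add, mul_one, Finset.sum_range_succ, Finset.sum_range_succ, ih, hf, add_zero,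
      Finset.sum_range_succ _ N]

/-- Expansion of the heat flow on the line, uniformly in space: expand `g` at `x` and integrate
against the Gaussian, whose odd moments vanish and whose even ones are `tⁿ (2n)! / n!`. -/
theorem exists_norm_integral_lineKernel_sub_le {N : ℕ} {g : ℝ → ℂ} {C : ℝ}
    (hg : ContDiff ℝ (2 * N : ℕ) g) (hC : ∀ x, ‖iteratedDeriv (2 * N) g x‖ ≤ C) :
    ∃ A : ℝ, ∀ t : ℝ, 0 < t → ∀ x : ℝ, ‖(∫ y, lineKernel t (x - y) • g y)
      - ∑ n ∈ Finset.range N, (t ^ n / (n.factorial : ℝ)) • iteratedDeriv (2 * n) g x‖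
        ≤ A * t ^ N := by
  refine ⟨C * ∫ w, lineKernel 1 w * |w| ^ (2 * N), fun t ht x => ?_⟩
  have hT : ∀ m, Integrable fun w => lineKernel 1 w •
      (((√t * w) ^ m / (m.factorial : ℝ)) • iteratedDeriv m g x) := by
    intro m
    refine (((integrable_lineKernel_one_mul_pow m).const_mul (√t ^ m / m.factorial)).smul_const
      (iteratedDeriv m g x)).congr (Filter.Eventually.of_forall fun w => ?_)
    simp only [smul_smul]
    congr 1
    rw [mul_pow]
    ring
  have hI : ∀ m, ∫ w, lineKernel 1 w •
      (((√t * w) ^ m / (m.factorial : ℝ)) • iteratedDeriv m g x)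
      = (√t ^ m / m.factorial * ∫ w, lineKernel 1 w * w ^ m) • iteratedDeriv m g x := by
    intro m
    rw [← integral_const_mul, ← integral_smul_const]
    refine integral_congr_ae (Filter.Eventually.of_forall fun w => ?_)
    simp only [smul_smul]
    congr 1
    rw [mul_pow]
    ring
  have hsum : ∑ n ∈ Finset.range N, (t ^ n / (n.factorial : ℝ)) • iteratedDeriv (2 * n) g x
      = ∫ w, lineKernel 1 w • ∑ m ∈ Finset.range (2 * N),
        ((√t * w) ^ m / (m.factorial : ℝ)) • iteratedDeriv m g x := by
    simp_rw [Finset.smul_sum]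
    rw [integral_finsetSum _ fun m _ => hT m, Finset.sum_congr rfl fun m _ => hI m,
      sum_range_two_mul_of_odd_eq_zero]
    · refine Finset.sum_congr rfl fun n _ => ?_
      rw [integral_lineKernel_one_mul_pow_even, pow_mul, Real.sq_sqrt ht.le]
      congr 1
      field_simp
    · intro n
      rw [integral_lineKernel_one_mul_pow_odd, mul_zero, zero_smul]
  rw [integral_lineKernel_smul g x ht, hsum, ← integral_sub (integrable_lineKernel_smul hg hC x √t)]
  · rw [mul_right_comm, ← integral_const_mul]
    refine norm_integral_le_of_norm_le
      ((integrable_lineKernel_one_mul_abs_pow (2 * N)).const_mul (C * t ^ N))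
      (Filter.Eventually.of_forall fun w => ?_)
    rw [← smul_sub, norm_smul, Real.norm_of_nonneg (lineKernel_nonneg _ _)]
    have := norm_sub_taylor_le hg hC x (x + √t * w)
    rw [add_sub_cancel_left, abs_mul, mul_pow, abs_of_nonneg (Real.sqrt_nonneg t), pow_mul (√t),
      Real.sq_sqrt ht.le] at this
    calc _ ≤ lineKernel 1 w * (C * (t ^ N * |w| ^ (2 * N))) :=
          mul_le_mul_of_nonneg_left this (lineKernel_nonneg _ _)
      _ = _ := by ring
  · simp_rw [Finset.smul_sum]
    exact integrable_finsetSum _ fun m _ => hT m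

/-! ### Boundary layers -/

/-- The absolute moments of the heat kernel of the line at time `1`. -/
noncomputable def absMoment (p : ℕ) : ℝ := ∫ w, lineKernel 1 w * |w| ^ p

theorem absMoment_nonneg (p : ℕ) : 0 ≤ absMoment p :=
  integral_nonneg fun w => mul_nonneg (lineKernel_nonneg _ _) (by positivity)

theorem integrable_lineKernel_mul_abs_pow (p : ℕ) {t : ℝ} (ht : 0 < t) :
    Integrable fun z => lineKernel t z * |z| ^ p := by
  have hs : 0 < √t := Real.sqrt_pos.2 ht
  rw [← integrable_comp_mul_left_iff _ hs.ne']
  refine ((integrable_lineKernel_one_mul_abs_pow p).const_mul ((√t)⁻¹ * √t ^ p)).congr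
    (Filter.Eventually.of_forall fun w => ?_)
  simp only
  rw [← lineKernel_scale ht, abs_mul, abs_of_pos hs, mul_pow]
  field_simp

theorem integral_lineKernel_mul_abs_pow (p : ℕ) {t : ℝ} (ht : 0 < t) :
    ∫ z, lineKernel t z * |z| ^ p = √t ^ p * absMoment p := by
  have hs : 0 < √t := Real.sqrt_pos.2 ht
  have h := Measure.integral_comp_mul_left (fun z => lineKernel t z * |z| ^ p) (√t)
  rw [abs_of_pos (inv_pos.2 hs), eq_inv_smul_iff₀ hs.ne'] at h
  rw [← h, absMoment, smul_eq_mul, ← integral_const_mul, ← integral_const_mul]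
  refine integral_congr_ae (Filter.Eventually.of_forall fun w => ?_)
  simp only
  rw [← lineKernel_scale ht, abs_mul, abs_of_pos hs, mul_pow]
  ring

section

variable {E : Type*} [NormedAddCommGroup E] [NormedSpace ℝ E]

theorem pow_mul_norm_lineKernel_smul_le {τ : ℝ → E} {q : ℕ} {C : ℝ}
    (hτ : ∀ v, 0 < v → ‖τ v‖ ≤ C * v ^ q) (P : ℕ) {x : ℝ} (hx : 0 ≤ x) (t : ℝ)
    {v : ℝ} (hv : 0 < v) :
    x ^ P * ‖lineKernel t (x + v) • τ v‖ ≤ C * (lineKernel t (x + v) * |x + v| ^ (P + q)) := by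
  have hC : 0 ≤ C := by simpa using (norm_nonneg _).trans (hτ 1 one_pos)
  rw [norm_smul, Real.norm_of_nonneg (lineKernel_nonneg _ _), abs_of_nonneg (by positivity)]
  have h0 := lineKernel_nonneg t (x + v)
  calc x ^ P * (lineKernel t (x + v) * ‖τ v‖)
      ≤ x ^ P * (lineKernel t (x + v) * (C * v ^ q)) := by gcongr; exact hτ v hv
    _ = C * (lineKernel t (x + v) * (x ^ P * v ^ q)) := by ring
    _ ≤ C * (lineKernel t (x + v) * ((x + v) ^ P * (x + v) ^ q)) := by gcongr <;> linarith
    _ = _ := by rw [pow_add]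

theorem integrableOn_lineKernel_smul {τ : ℝ → E} {q : ℕ} {C : ℝ} (hτc : Continuous τ)
    (hτ : ∀ v, 0 < v → ‖τ v‖ ≤ C * v ^ q) {x : ℝ} (hx : 0 ≤ x) {t : ℝ} (ht : 0 < t) :
    IntegrableOn (fun v => lineKernel t (x + v) • τ v) (Set.Ioi 0) := by
  refine Integrable.mono' (((integrable_lineKernel_mul_abs_pow (0 + q) ht).comp_add_left
    x).const_mul C).integrableOn ?_ ?_
  · have := continuous_lineKernel t
    exact Continuous.aestronglyMeasurable (by fun_prop)
  · filter_upwards [ae_restrict_mem measurableSet_Ioi] with v hv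
    simpa using pow_mul_norm_lineKernel_smul_le hτ 0 hx t hv

/-- A factor `v^q` and a weight `x^P` in front of `∫₀^∞ G_t(x + v) τ(v) dv` each contribute their
degree to the power of `√t`, since `x` and `v` are both at most `x + v`. -/
theorem pow_mul_norm_integral_lineKernel_le {τ : ℝ → E} {q : ℕ} {C : ℝ}
    (hτ : ∀ v, 0 < v → ‖τ v‖ ≤ C * v ^ q) (P : ℕ) {x : ℝ} (hx : 0 ≤ x) {t : ℝ} (ht : 0 < t) :
    x ^ P * ‖∫ v in Set.Ioi 0, lineKernel t (x + v) • τ v‖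
      ≤ C * (√t ^ (P + q) * absMoment (P + q)) := by
  have hC : 0 ≤ C := by simpa using (norm_nonneg _).trans (hτ 1 one_pos)
  have hi := (integrable_lineKernel_mul_abs_pow (P + q) ht).comp_add_left x
  calc x ^ P * ‖∫ v in Set.Ioi 0, lineKernel t (x + v) • τ v‖
      ≤ x ^ P * ∫ v in Set.Ioi 0, ‖lineKernel t (x + v) • τ v‖ := by
        gcongr
        exact norm_integral_le_integral_norm _
    _ = ∫ v in Set.Ioi 0, x ^ P * ‖lineKernel t (x + v) • τ v‖ := (integral_const_mul _ _).symm
    _ ≤ ∫ v in Set.Ioi 0, C * (lineKernel t (x + v) * |x + v| ^ (P + q)) := by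
        refine integral_mono_of_nonneg (Filter.Eventually.of_forall fun v => by positivity)
          (hi.const_mul C).integrableOn ?_
        filter_upwards [ae_restrict_mem measurableSet_Ioi] with v hv
        exact pow_mul_norm_lineKernel_smul_le hτ P hx t hv
    _ = C * ∫ v in Set.Ioi 0, lineKernel t (x + v) * |x + v| ^ (P + q) := integral_const_mul _ _
    _ ≤ C * ∫ v, lineKernel t (x + v) * |x + v| ^ (P + q) := by
        refine mul_le_mul_of_nonneg_left (setIntegral_le_integral hi ?_) hC
        exact Filter.Eventually.of_forall fun v =>
          mul_nonneg (lineKernel_nonneg _ _) (by positivity)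
    _ = _ := by
        rw [integral_add_left_eq_self (fun z => lineKernel t z * |z| ^ (P + q)) x,
          integral_lineKernel_mul_abs_pow _ ht]

theorem stronglyMeasurable_integral_lineKernel_smul {τ : ℝ → E} (hτ : Continuous τ) (t : ℝ) :
    StronglyMeasurable fun x => ∫ v in Set.Ioi 0, lineKernel t (x + v) • τ v := by
  refine StronglyMeasurable.integral_prod_right (f := fun x v => lineKernel t (x + v) • τ v)
    (Continuous.stronglyMeasurable ?_)
  have := continuous_lineKernel t
  simp only [Function.uncurry_def]
  fun_prop

end

/-- `∫₀^∞ G_t(x + v) v^l dv`, the heat flow from the half-line `{-v | v > 0}` to the point `x`,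
started from the function `v^l` of the distance `v` to the endpoint `0`. -/
noncomputable def boundaryLayer (l : ℕ) (t x : ℝ) : ℝ :=
  ∫ v in Set.Ioi 0, lineKernel t (x + v) • v ^ l

theorem norm_pow_le_one_mul_pow (l : ℕ) (v : ℝ) (hv : 0 < v) : ‖v ^ l‖ ≤ 1 * v ^ l := by
  rw [one_mul, Real.norm_of_nonneg (by positivity)]

theorem boundaryLayer_nonneg (l : ℕ) (t x : ℝ) : 0 ≤ boundaryLayer l t x :=
  setIntegral_nonneg measurableSet_Ioi fun _ hv =>
    mul_nonneg (lineKernel_nonneg _ _) (pow_nonneg (le_of_lt hv) l)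

theorem measurable_boundaryLayer (l : ℕ) (t : ℝ) : Measurable (boundaryLayer l t) :=
  (stronglyMeasurable_integral_lineKernel_smul (continuous_pow l) t).measurable

theorem pow_mul_boundaryLayer_le (P l : ℕ) {x : ℝ} (hx : 0 ≤ x) {t : ℝ} (ht : 0 < t) :
    x ^ P * boundaryLayer l t x ≤ √t ^ (P + l) * absMoment (P + l) := by
  have := pow_mul_norm_integral_lineKernel_le (norm_pow_le_one_mul_pow l) P hx ht
  rwa [one_mul, ← boundaryLayer, Real.norm_of_nonneg (boundaryLayer_nonneg _ _ _)] at this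

theorem boundaryLayer_scale (l : ℕ) {t : ℝ} (ht : 0 < t) (u : ℝ) :
    boundaryLayer l t (√t * u) = √t ^ l * boundaryLayer l 1 u := by
  have hs : 0 < √t := Real.sqrt_pos.2 ht
  have h := integral_comp_mul_left_Ioi (fun v => lineKernel t (√t * u + v) • v ^ l) 0 hs
  rw [mul_zero, eq_inv_smul_iff₀ hs.ne'] at h
  rw [boundaryLayer, ← h, boundaryLayer, smul_eq_mul, ← integral_const_mul, ← integral_const_mul]
  refine integral_congr_ae (Filter.Eventually.of_forall fun w => ?_)
  simp only [smul_eq_mul]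
  rw [← mul_add, ← lineKernel_scale ht, mul_pow]
  ring

theorem norm_ofReal_cpow {x : ℝ} (hx : 0 < x) (s : ℂ) : ‖(x : ℂ) ^ s‖ = x ^ s.re :=
  Complex.norm_cpow_eq_rpow_re_of_pos hx s

/-- The double integrand in `c k l α` is integrable. -/
theorem integrable_exp_mul_cpow_mul_pow (k l : ℕ) {α : ℂ} (hα : α.re < 1) :
    Integrable (Function.uncurry fun u v : ℝ =>
      (Real.exp (-(u + v) ^ 2 / 4) : ℂ) * (u : ℂ) ^ ((k : ℂ) - α) * (v : ℂ) ^ l)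
      ((volume.restrict (Set.Ioi 0)).prod (volume.restrict (Set.Ioi 0))) := by
  have h1 : IntegrableOn (fun u : ℝ => u ^ ((k : ℝ) - α.re) * Real.exp (-(1 / 4) * u ^ 2))
      (Set.Ioi 0) := integrableOn_rpow_mul_exp_neg_mul_sq (by norm_num) (by
        have : (0 : ℝ) ≤ k := k.cast_nonneg
        linarith)
  have h2 : IntegrableOn (fun v : ℝ => v ^ (l : ℝ) * Real.exp (-(1 / 4) * v ^ 2))
      (Set.Ioi 0) := integrableOn_rpow_mul_exp_neg_mul_sq (by norm_num) (by
        have : (0 : ℝ) ≤ l := l.cast_nonneg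
        linarith)
  refine (Integrable.mul_prod h1 h2).mono' ?_ ?_
  · have hm : Measurable fun u : ℝ => (u : ℂ) ^ ((k : ℂ) - α) := by fun_prop
    refine Measurable.aestronglyMeasurable ?_
    simp only [Function.uncurry_def]
    fun_prop
  · rw [Measure.prod_restrict]
    filter_upwards [ae_restrict_mem (measurableSet_Ioi.prod measurableSet_Ioi)] with p hp
    obtain ⟨hu, hv⟩ := hp
    simp only [Set.mem_Ioi] at hu hv
    simp only [Function.uncurry_def]
    rw [norm_mul, norm_mul, norm_ofReal_cpow hu, norm_pow, Complex.norm_real, Complex.norm_real,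
      Real.norm_of_nonneg (Real.exp_pos _).le, Real.norm_of_nonneg hv.le, Real.rpow_natCast,
      Complex.sub_re, Complex.natCast_re]
    have h3 : Real.exp (-(p.1 + p.2) ^ 2 / 4)
        ≤ Real.exp (-(1 / 4) * p.1 ^ 2) * Real.exp (-(1 / 4) * p.2 ^ 2) := by
      rw [← Real.exp_add]
      gcongr
      nlinarith [mul_pos hu hv]
    calc _ = Real.exp (-(p.1 + p.2) ^ 2 / 4) * (p.1 ^ ((k : ℝ) - α.re) * p.2 ^ l) := by ring
      _ ≤ Real.exp (-(1 / 4) * p.1 ^ 2) * Real.exp (-(1 / 4) * p.2 ^ 2)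
          * (p.1 ^ ((k : ℝ) - α.re) * p.2 ^ l) := by gcongr
      _ = _ := by ring

theorem ofReal_boundaryLayer_one_mul (k l : ℕ) (α : ℂ) (u : ℝ) :
    (u : ℂ) ^ ((k : ℂ) - α) * (boundaryLayer l 1 u : ℂ) = (1 / (√(4 * π) : ℂ)) *
      ∫ v in Set.Ioi (0 : ℝ), (Real.exp (-(u + v) ^ 2 / 4) : ℂ) * (u : ℂ) ^ ((k : ℂ) - α)
        * (v : ℂ) ^ l := by
  rw [boundaryLayer, ← integral_complex_ofReal, ← integral_const_mul, ← integral_const_mul]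
  refine integral_congr_ae (Filter.Eventually.of_forall fun v => ?_)
  simp only [smul_eq_mul, lineKernel, mul_one]
  push_cast
  ring

theorem integrableOn_cpow_mul_boundaryLayer_one (k l : ℕ) {α : ℂ} (hα : α.re < 1) :
    IntegrableOn (fun u : ℝ => (u : ℂ) ^ ((k : ℂ) - α) * (boundaryLayer l 1 u : ℂ))
      (Set.Ioi 0) := by
  simp_rw [ofReal_boundaryLayer_one_mul]
  exact (integrable_exp_mul_cpow_mul_pow k l hα).integral_prod_left.const_mul _

theorem integral_cpow_mul_boundaryLayer_one (k l : ℕ) {α : ℂ} (hα : α.re < 1) :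
    ∫ u in Set.Ioi (0 : ℝ), (u : ℂ) ^ ((k : ℂ) - α) * (boundaryLayer l 1 u : ℂ)
      = (-1) ^ (l + 1) * c k l α := by
  simp_rw [ofReal_boundaryLayer_one_mul]
  rw [integral_const_mul, integral_integral_swap (integrable_exp_mul_cpow_mul_pow k l hα), c,
    ← mul_assoc, ← mul_assoc, ← pow_add, Even.neg_one_pow ⟨l + 1, rfl⟩, one_mul]

theorem sqrt_mul_cpow_mul_boundaryLayer (k l : ℕ) (α : ℂ) {t : ℝ} (ht : 0 < t) {u : ℝ}
    (hu : 0 < u) :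
    (√t : ℂ) * (((√t * u : ℝ) : ℂ) ^ ((k : ℂ) - α) * (boundaryLayer l t (√t * u) : ℂ))
      = (t : ℂ) ^ ((1 + ((k + l : ℕ) : ℂ) - α) / 2) *
        ((u : ℂ) ^ ((k : ℂ) - α) * (boundaryLayer l 1 u : ℂ)) := by
  have hs : 0 < √t := Real.sqrt_pos.2 ht
  have hsc : (√t : ℂ) ≠ 0 := by exact_mod_cast hs.ne'
  have ht2 : (t : ℂ) ^ ((1 + ((k + l : ℕ) : ℂ) - α) / 2)
      = (√t : ℂ) ^ (1 + ((k + l : ℕ) : ℂ) - α) := by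
    have h : (t : ℂ) = (√t : ℂ) * (√t : ℂ) := by
      rw [← Complex.ofReal_mul, Real.mul_self_sqrt ht.le]
    rw [h, Complex.mul_cpow_ofReal_nonneg hs.le hs.le, ← Complex.cpow_add _ _ hsc, add_halves]
  rw [boundaryLayer_scale l ht, Complex.ofReal_mul, Complex.mul_cpow_ofReal_nonneg hs.le hu.le, ht2,
    show 1 + ((k + l : ℕ) : ℂ) - α = ((k : ℂ) - α) + ((1 + l : ℕ) : ℂ) by push_cast; ring,
    Complex.cpow_add _ _ hsc, Complex.cpow_natCast]
  push_cast
  ring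

theorem integrableOn_cpow_mul_boundaryLayer (k l : ℕ) {α : ℂ} (hα : α.re < 1) {t : ℝ}
    (ht : 0 < t) :
    IntegrableOn (fun x : ℝ => (x : ℂ) ^ ((k : ℂ) - α) * (boundaryLayer l t x : ℂ))
      (Set.Ioi 0) := by
  have hs : 0 < √t := Real.sqrt_pos.2 ht
  have hsc : (√t : ℂ) ≠ 0 := by exact_mod_cast hs.ne'
  have h := integrableOn_Ioi_comp_mul_left_iff
    (fun x : ℝ => (x : ℂ) ^ ((k : ℂ) - α) * (boundaryLayer l t x : ℂ)) 0 hs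
  rw [mul_zero] at h
  refine h.1 ?_
  refine IntegrableOn.congr_fun ((integrableOn_cpow_mul_boundaryLayer_one k l hα).const_mul
    ((√t : ℂ)⁻¹ * (t : ℂ) ^ ((1 + ((k + l : ℕ) : ℂ) - α) / 2))) (fun u hu => ?_)
    measurableSet_Ioi
  rw [mul_assoc, ← sqrt_mul_cpow_mul_boundaryLayer k l α ht hu, inv_mul_cancel_left₀ hsc]

/-- By scaling, a power `x^{k-α}` paired with the boundary layer of `v^l` contributes exactly one
term of the boundary expansion, up to the sign contained in `c k l α`. -/
theorem integral_cpow_mul_boundaryLayer (k l : ℕ) {α : ℂ} (hα : α.re < 1) {t : ℝ} (ht : 0 < t) :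
    ∫ x in Set.Ioi (0 : ℝ), (x : ℂ) ^ ((k : ℂ) - α) * (boundaryLayer l t x : ℂ)
      = (t : ℂ) ^ ((1 + ((k + l : ℕ) : ℂ) - α) / 2) * ((-1) ^ (l + 1) * c k l α) := by
  have hs : 0 < √t := Real.sqrt_pos.2 ht
  have h := integral_comp_mul_left_Ioi
    (fun x : ℝ => (x : ℂ) ^ ((k : ℂ) - α) * (boundaryLayer l t x : ℂ)) 0 hs
  rw [mul_zero, eq_inv_smul_iff₀ hs.ne'] at h
  rw [← h, Complex.real_smul, ← integral_const_mul, ← integral_cpow_mul_boundaryLayer_one k l hα,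
    ← integral_const_mul]
  exact setIntegral_congr_fun measurableSet_Ioi fun u hu =>
    sqrt_mul_cpow_mul_boundaryLayer k l α ht hu

/-! ### The contribution of an endpoint -/

theorem natCast_le_infty (n : ℕ) : (n : WithTop ℕ∞) ≤ ∞ := by
  exact_mod_cast le_top

/-- The one-sided Taylor coefficients can be read off from any extension of `F`. -/
theorem taylorCoeff_eq {F g : ℝ → ℂ} {b : ℝ} (hb : 0 < b) {n k : ℕ} (hg : ContDiff ℝ n g)
    (hgF : Set.EqOn g F (Set.Icc 0 b)) (hk : k ≤ n) :
    taylorCoeff F k = iteratedDeriv k g 0 / (k.factorial : ℂ) := by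
  have h0 : (0 : ℝ) ∈ Set.Icc 0 b := ⟨le_rfl, hb.le⟩
  have hset : (Set.Ico 0 π : Set ℝ) =ᶠ[𝓝 0] Set.Icc 0 b := by
    filter_upwards [Iio_mem_nhds hb, Iio_mem_nhds Real.pi_pos] with x hx hx'
    have h1 : x < b := hx
    have h2 : x < π := hx'
    exact propext ⟨fun h => ⟨h.1, h1.le⟩, fun h => ⟨h.1, h2⟩⟩
  rw [taylorCoeff, iteratedDerivWithin, iteratedFDerivWithin_congr_set hset, ← iteratedDerivWithin,
    ← iteratedDerivWithin_congr hgF h0, iteratedDerivWithin_eq_iteratedDeriv (uniqueDiffOn_Icc hb)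
    ((hg.of_le (by exact_mod_cast hk)).contDiffAt) h0]

theorem IsRegularPart.eq_cpow_neg_mul {α : ℂ} {φ F : ℝ → ℂ} (hF : IsRegularPart α φ F) {x : ℝ}
    (hx : x ∈ Set.Ioo 0 π) : φ x = (x : ℂ) ^ (-α) * F x := by
  have hx0 : (x : ℂ) ≠ 0 := by exact_mod_cast hx.1.ne'
  rw [hF.eq_of_mem x hx, ← mul_assoc, ← Complex.cpow_add _ _ hx0, neg_add_cancel, Complex.cpow_zero,
    one_mul]

theorem IsRegularPart.integrableOn {α : ℂ} (hα : α.re < 1) {φ F : ℝ → ℂ}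
    (hF : IsRegularPart α φ F) : IntegrableOn φ (Set.Ioc 0 (π / 2)) := by
  have h1 : IntegrableOn (fun x : ℝ => (x : ℂ) ^ (-α)) (Set.Icc 0 (π / 2)) := by
    rw [integrableOn_Icc_iff_integrableOn_Ioc,
      ← intervalIntegrable_iff_integrableOn_Ioc_of_le (by positivity)]
    exact intervalIntegral.intervalIntegrable_cpow' (by rw [Complex.neg_re]; linarith)
  have h2 : ContinuousOn F (Set.Icc 0 (π / 2)) := hF.contDiffOn.continuousOn.mono
    fun x hx => ⟨hx.1, by linarith [hx.2, Real.pi_pos]⟩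
  refine IntegrableOn.congr_fun ((h1.mul_continuousOn h2 isCompact_Icc).mono_set
    Set.Ioc_subset_Icc_self) (fun x hx => ?_) measurableSet_Ioc
  exact (hF.eq_cpow_neg_mul ⟨hx.1, by linarith [hx.2, Real.pi_pos]⟩).symm

theorem intervalIntegrable_of_isRegularPart {α : ℂ} (hα : α.re < 1) {φ F₀ Fπ : ℝ → ℂ}
    (hF₀ : IsRegularPart α φ F₀) (hFπ : IsRegularPart α (reflect φ) Fπ) :
    IntervalIntegrable φ volume 0 π := by
  have h1 : IntervalIntegrable φ volume 0 (π / 2) := by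
    rw [intervalIntegrable_iff_integrableOn_Ioc_of_le (by positivity)]
    exact hF₀.integrableOn hα
  have h2 : IntervalIntegrable (reflect φ) volume 0 (π / 2) := by
    rw [intervalIntegrable_iff_integrableOn_Ioc_of_le (by positivity)]
    exact hFπ.integrableOn hα
  have h3 := h2.comp_sub_left π
  simp only [reflect, sub_sub_cancel, sub_zero, sub_half] at h3
  exact h1.trans h3.symm

/-- Near `0` a function with regular part `F` is approximated by the powers `x^{k-α}`; the error
is `O(x^L)` near `0` up to an integrable factor `w`, and away from `0` the additional weight
`x^(L + m)` absorbs the growth of the powers, so that `w` is integrable on the whole half-line. -/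
theorem exists_norm_sub_cpow_sum_le {α : ℂ} (hα : α.re < 1) {φ F : ℝ → ℂ}
    (hF : IsRegularPart α φ F) (hφ : IntegrableOn φ (Set.Ioc 0 π)) (L : ℕ) :
    ∃ (m : ℕ) (w : ℝ → ℝ), IntegrableOn w (Set.Ioi 0) ∧ ∀ x, 0 < x → 0 ≤ w x ∧
      ‖(Set.Ioc 0 π).indicator φ x
        - ∑ k ∈ Finset.range L, taylorCoeff F k * (x : ℂ) ^ ((k : ℂ) - α)‖
        ≤ (x ^ L + x ^ (L + m)) * w x := by
  have hπ2 : 0 < π / 2 := by positivity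
  obtain ⟨g, hg, hgF, C, hC⟩ := exists_contDiff_extension hπ2 L F
    ((hF.contDiffOn.of_le (natCast_le_infty _)).mono
      fun x hx => ⟨hx.1, by linarith [hx.2, Real.pi_pos]⟩)
  have hC0 : 0 ≤ C := (norm_nonneg _).trans (hC 0)
  obtain ⟨m, hm⟩ := exists_nat_ge (2 - α.re)
  set B : ℝ := ∑ k ∈ Finset.range L, ‖taylorCoeff F k‖
  have hB0 : 0 ≤ B := Finset.sum_nonneg fun k _ => norm_nonneg _
  refine ⟨m, fun x => (Set.Ioc 0 (π / 2)).indicator (fun x => C * x ^ (-α.re)) x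
    + (Set.Ioc 0 π).indicator (fun x => ‖φ x‖) x
    + (Set.Ioi (π / 2)).indicator (fun x => B * x ^ (-2 : ℝ)) x, ?_, fun x hx => ?_⟩
  · refine Integrable.integrableOn ?_
    refine Integrable.add (Integrable.add ?_ ?_) ?_
    · rw [integrable_indicator_iff measurableSet_Ioc]
      refine Integrable.const_mul ?_ _
      change IntegrableOn _ _ _
      rw [← intervalIntegrable_iff_integrableOn_Ioc_of_le hπ2.le]
      exact intervalIntegral.intervalIntegrable_rpow' (by linarith)
    · rw [integrable_indicator_iff measurableSet_Ioc]
      exact hφ.norm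
    · rw [integrable_indicator_iff measurableSet_Ioi]
      exact (integrableOn_Ioi_rpow_of_lt (by norm_num) hπ2).const_mul _
  · have h1 : 0 ≤ (Set.Ioc 0 (π / 2)).indicator (fun x => C * x ^ (-α.re)) x :=
      Set.indicator_apply_nonneg fun _ => by positivity
    have h2 : 0 ≤ (Set.Ioc 0 π).indicator (fun x => ‖φ x‖) x :=
      Set.indicator_apply_nonneg fun _ => by positivity
    have h3 : 0 ≤ (Set.Ioi (π / 2)).indicator (fun x => B * x ^ (-2 : ℝ)) x :=
      Set.indicator_apply_nonneg fun _ => by positivity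
    refine ⟨by positivity, ?_⟩
    beta_reduce
    have hxL : 0 < x ^ L := by positivity
    have hxm : 0 < x ^ (L + m) := by positivity
    rcases le_or_gt x (π / 2) with hle | hgt
    · have hx1 : x ∈ Set.Ioc 0 (π / 2) := ⟨hx, hle⟩
      have hx2 : x ∈ Set.Ioc 0 π := ⟨hx, by linarith⟩
      have hx0 : (x : ℂ) ≠ 0 := by exact_mod_cast hx.ne'
      have hE : (Set.Ioc 0 π).indicator φ x
          - ∑ k ∈ Finset.range L, taylorCoeff F k * (x : ℂ) ^ ((k : ℂ) - α)
          = (x : ℂ) ^ (-α) * (g x - ∑ k ∈ Finset.range L,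
              ((x - 0) ^ k / (k.factorial : ℝ)) • iteratedDeriv k g 0) := by
        rw [Set.indicator_of_mem hx2, hF.eq_cpow_neg_mul ⟨hx, by linarith⟩, mul_sub, Finset.mul_sum,
          hgF ⟨hx.le, hle⟩]
        congr 1
        refine Finset.sum_congr rfl fun k hk => ?_
        rw [taylorCoeff_eq hπ2 hg hgF (Finset.mem_range.1 hk).le, sub_eq_neg_add,
          Complex.cpow_add _ _ hx0, Complex.cpow_natCast, sub_zero, Complex.real_smul]
        push_cast
        ring
      rw [hE, norm_mul, norm_ofReal_cpow hx, Complex.neg_re]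
      have hT := norm_sub_taylor_le hg hC 0 x
      rw [sub_zero, abs_of_pos hx] at hT
      rw [Set.indicator_of_mem hx1] at h1 ⊢
      calc x ^ (-α.re) * _ ≤ x ^ (-α.re) * (C * x ^ L) :=
            mul_le_mul_of_nonneg_left (by simpa using hT) (by positivity)
        _ = x ^ L * (C * x ^ (-α.re)) := by ring
        _ ≤ _ := mul_le_mul (by linarith) (by linarith) h1 (by positivity)
    · have hx1 : 1 ≤ x := by linarith [Real.pi_gt_three]
      have hsum : ‖∑ k ∈ Finset.range L, taylorCoeff F k * (x : ℂ) ^ ((k : ℂ) - α)‖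
          ≤ x ^ (L + m) * (B * x ^ (-2 : ℝ)) := by
        calc _ ≤ ∑ k ∈ Finset.range L, ‖taylorCoeff F k‖ * x ^ (((L + m : ℕ) : ℝ) + -2) := by
              refine norm_sum_le_of_le _ fun k hk => ?_
              rw [norm_mul, norm_ofReal_cpow hx, Complex.sub_re, Complex.natCast_re]
              gcongr
              have : (k : ℝ) ≤ L := by exact_mod_cast (Finset.mem_range.1 hk).le
              push_cast
              linarith
          _ = _ := by
              rw [← Finset.sum_mul, Real.rpow_add hx, Real.rpow_natCast]
              ring
      have hind : ‖(Set.Ioc 0 π).indicator φ x‖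
          ≤ x ^ L * (Set.Ioc 0 π).indicator (fun x => ‖φ x‖) x := by
        rw [norm_indicator_eq_indicator_norm]
        exact le_mul_of_one_le_left h2 (one_le_pow₀ hx1)
      rw [Set.indicator_of_mem (show x ∈ Set.Ioi (π / 2) from hgt)] at h3 ⊢
      refine (norm_sub_le _ _).trans ((add_le_add hind hsum).trans ?_)
      nlinarith [mul_nonneg hxL.le h1, mul_nonneg hxL.le h3, mul_nonneg hxm.le h1,
        mul_nonneg hxm.le h2]

theorem integrableOn_mul_boundaryLayer {φ : ℝ → ℂ} (hφ : IntegrableOn φ (Set.Ioc 0 π)) (l : ℕ)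
    {t : ℝ} (ht : 0 < t) :
    IntegrableOn (fun x => φ x * (boundaryLayer l t x : ℂ)) (Set.Ioc 0 π) := by
  refine Integrable.mul_bdd (c := √t ^ (0 + l) * absMoment (0 + l)) hφ
    (Complex.measurable_ofReal.comp (measurable_boundaryLayer l t)).aestronglyMeasurable ?_
  filter_upwards [ae_restrict_mem measurableSet_Ioc] with x hx
  rw [Complex.norm_real, Real.norm_of_nonneg (boundaryLayer_nonneg _ _ _)]
  simpa using pow_mul_boundaryLayer_le 0 l hx.1.le ht

theorem exists_norm_integral_mul_boundaryLayer_sub_le {α : ℂ} (hα : α.re < 1) {φ F : ℝ → ℂ}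
    (hF : IsRegularPart α φ F) (hφ : IntegrableOn φ (Set.Ioc 0 π)) (L l : ℕ) :
    ∃ A : ℝ, ∀ t : ℝ, 0 < t → t ≤ 1 →
      ‖(∫ x in Set.Ioc 0 π, φ x * (boundaryLayer l t x : ℂ))
        - ∑ k ∈ Finset.range L, (t : ℂ) ^ ((1 + ((k + l : ℕ) : ℂ) - α) / 2) *
            ((-1) ^ (l + 1) * c k l α * taylorCoeff F k)‖ ≤ A * √t ^ (L + l) := by
  obtain ⟨m, w, hw, hE⟩ := exists_norm_sub_cpow_sum_le hα hF hφ L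
  refine ⟨(absMoment (L + l) + absMoment (L + m + l)) * ∫ x in Set.Ioi 0, w x,
    fun t ht ht1 => ?_⟩
  have hind : ∀ x, (Set.Ioc 0 π).indicator φ x * (boundaryLayer l t x : ℂ)
      = (Set.Ioc 0 π).indicator (fun x => φ x * (boundaryLayer l t x : ℂ)) x := fun x =>
    (Set.indicator_mul_left (Set.Ioc 0 π) φ fun x => (boundaryLayer l t x : ℂ)).symm
  have h1 : ∫ x in Set.Ioc 0 π, φ x * (boundaryLayer l t x : ℂ)
      = ∫ x in Set.Ioi 0, (Set.Ioc 0 π).indicator φ x * (boundaryLayer l t x : ℂ) := by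
    simp_rw [hind]
    rw [setIntegral_indicator measurableSet_Ioc, Set.inter_eq_self_of_subset_right]
    exact Set.Ioc_subset_Ioi_self
  have hi1 : IntegrableOn (fun x => (Set.Ioc 0 π).indicator φ x * (boundaryLayer l t x : ℂ))
      (Set.Ioi 0) := by
    refine Integrable.integrableOn ?_
    simp_rw [hind]
    rw [integrable_indicator_iff measurableSet_Ioc]
    exact integrableOn_mul_boundaryLayer hφ l ht
  have hi2 : ∀ k ∈ Finset.range L, IntegrableOn (fun x : ℝ =>
      taylorCoeff F k * ((x : ℂ) ^ ((k : ℂ) - α) * (boundaryLayer l t x : ℂ))) (Set.Ioi 0) :=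
    fun k _ => (integrableOn_cpow_mul_boundaryLayer k l hα ht).const_mul _
  have h2 : ∑ k ∈ Finset.range L, (t : ℂ) ^ ((1 + ((k + l : ℕ) : ℂ) - α) / 2) *
      ((-1) ^ (l + 1) * c k l α * taylorCoeff F k)
      = ∫ x in Set.Ioi (0 : ℝ), ∑ k ∈ Finset.range L,
        taylorCoeff F k * ((x : ℂ) ^ ((k : ℂ) - α) * (boundaryLayer l t x : ℂ)) := by
    rw [integral_finsetSum _ hi2]
    refine Finset.sum_congr rfl fun k _ => ?_
    rw [integral_const_mul, integral_cpow_mul_boundaryLayer k l hα ht]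
    ring
  rw [h1, h2, ← integral_sub hi1 (integrable_finsetSum _ hi2)]
  have hst : √t ≤ 1 := Real.sqrt_le_one.2 ht1
  rw [mul_right_comm, ← integral_const_mul]
  refine norm_integral_le_of_norm_le (hw.const_mul _) ?_
  filter_upwards [ae_restrict_mem measurableSet_Ioi] with x hx
  have hx0 : 0 < x := hx
  obtain ⟨hwx, hEx⟩ := hE x hx0
  have hfac : (Set.Ioc 0 π).indicator φ x * (boundaryLayer l t x : ℂ) - ∑ k ∈ Finset.range L,
      taylorCoeff F k * ((x : ℂ) ^ ((k : ℂ) - α) * (boundaryLayer l t x : ℂ))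
      = ((Set.Ioc 0 π).indicator φ x - ∑ k ∈ Finset.range L,
        taylorCoeff F k * (x : ℂ) ^ ((k : ℂ) - α)) * (boundaryLayer l t x : ℂ) := by
    rw [sub_mul, Finset.sum_mul]
    simp only [mul_assoc]
  rw [hfac, norm_mul, Complex.norm_real, Real.norm_of_nonneg (boundaryLayer_nonneg _ _ _)]
  have hb := boundaryLayer_nonneg l t x
  have hb1 := pow_mul_boundaryLayer_le L l hx0.le ht
  have hb2 := pow_mul_boundaryLayer_le (L + m) l hx0.le ht
  have hp : √t ^ (L + m + l) ≤ √t ^ (L + l) :=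
    pow_le_pow_of_le_one (Real.sqrt_nonneg _) hst (by omega)
  calc _ ≤ (x ^ L + x ^ (L + m)) * w x * boundaryLayer l t x := by gcongr
    _ = (x ^ L * boundaryLayer l t x + x ^ (L + m) * boundaryLayer l t x) * w x := by ring
    _ ≤ (√t ^ (L + l) * absMoment (L + l) + √t ^ (L + l) * absMoment (L + m + l)) * w x := by
        exact mul_le_mul_of_nonneg_right (add_le_add hb1 (hb2.trans
          (mul_le_mul_of_nonneg_right hp (absMoment_nonneg _)))) hwx
    _ = _ := by ring

/-- Expansion of the contribution of the negative half-line, where the initial function is `σ`: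
expand `σ` at `0`, and then `φ` against each boundary layer. The order `J - l` to which `φ` is
expanded against `v^l` makes all errors of size `√t ^ J`. -/
theorem exists_norm_boundary_integral_sub_le {α : ℂ} (hα : α.re < 1) {φ F : ℝ → ℂ}
    (hF : IsRegularPart α φ F) (hφ : IntegrableOn φ (Set.Ioc 0 π)) (J : ℕ) {σ : ℝ → ℂ}
    (hσ : ContDiff ℝ J σ) {C : ℝ} (hC : ∀ x, ‖iteratedDeriv J σ x‖ ≤ C) :
    ∃ A : ℝ, ∀ t : ℝ, 0 < t → t ≤ 1 →
      IntegrableOn (fun x => φ x * ∫ v in Set.Ioi 0, lineKernel t (x + v) • σ (-v))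
        (Set.Ioc 0 π) ∧
      ‖(∫ x in Set.Ioc 0 π, φ x * ∫ v in Set.Ioi 0, lineKernel t (x + v) • σ (-v))
        + ∑ l ∈ Finset.range J, ∑ k ∈ Finset.range (J - l),
          (t : ℂ) ^ ((1 + ((k + l : ℕ) : ℂ) - α) / 2) *
            (c k l α * taylorCoeff F k * (iteratedDeriv l σ 0 / (l.factorial : ℂ)))‖
        ≤ A * √t ^ J := by
  choose A hA using fun l => exists_norm_integral_mul_boundaryLayer_sub_le hα hF hφ (J - l) l
  set s : ℕ → ℂ := fun l => iteratedDeriv l σ 0 / (l.factorial : ℂ) with hs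
  set R : ℝ → ℂ := fun v =>
    σ (-v) - ∑ l ∈ Finset.range J, ((v ^ l : ℝ) : ℂ) * ((-1) ^ l * s l) with hR
  have hRc : Continuous R := by
    have := hσ.continuous
    fun_prop
  have hRle : ∀ v, 0 < v → ‖R v‖ ≤ C * v ^ J := by
    intro v hv
    have := norm_sub_taylor_le hσ hC 0 (-v)
    rw [sub_zero, abs_neg, abs_of_pos hv] at this
    have e : R v = σ (-v) - ∑ l ∈ Finset.range J,
        ((-v) ^ l / (l.factorial : ℝ)) • iteratedDeriv l σ 0 := by
      simp only [hR, hs]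
      congr 1
      refine Finset.sum_congr rfl fun l _ => ?_
      rw [Complex.real_smul, neg_pow v]
      push_cast
      ring
    rwa [e]
  refine ⟨∑ l ∈ Finset.range J, A l * ‖(-1) ^ l * s l‖
    + (C * absMoment J) * ∫ x in Set.Ioc 0 π, ‖φ x‖, fun t ht ht1 => ?_⟩
  have hinner : ∀ x ∈ Set.Ioc (0 : ℝ) π, ∫ v in Set.Ioi 0, lineKernel t (x + v) • σ (-v)
      = ∑ l ∈ Finset.range J, (boundaryLayer l t x : ℂ) * ((-1) ^ l * s l)
        + ∫ v in Set.Ioi 0, lineKernel t (x + v) • R v := by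
    intro x hx
    have hil : ∀ l ∈ Finset.range J, IntegrableOn (fun v : ℝ =>
        ((lineKernel t (x + v) • v ^ l : ℝ) : ℂ) * ((-1) ^ l * s l)) (Set.Ioi 0) := fun l _ =>
      (integrableOn_lineKernel_smul (continuous_pow l) (norm_pow_le_one_mul_pow l) hx.1.le
        ht).ofReal.mul_const _
    have hiR := integrableOn_lineKernel_smul hRc hRle hx.1.le ht
    have hl : ∀ l, (boundaryLayer l t x : ℂ) * ((-1) ^ l * s l)
        = ∫ v in Set.Ioi (0 : ℝ), ((lineKernel t (x + v) • v ^ l : ℝ) : ℂ) * ((-1) ^ l * s l) := by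
      intro l
      rw [integral_mul_const, integral_complex_ofReal, boundaryLayer]
    simp_rw [hl]
    rw [← integral_finsetSum _ hil, ← integral_add (integrable_finsetSum _ hil) hiR]
    refine integral_congr_ae (Filter.Eventually.of_forall fun v => ?_)
    simp only [hR, smul_eq_mul, Complex.real_smul, mul_sub, Finset.mul_sum]
    rw [← sub_eq_iff_eq_add']
    congr 1
    refine Finset.sum_congr rfl fun l _ => ?_
    push_cast
    ring
  have hHR : IntegrableOn (fun x => φ x * ∫ v in Set.Ioi 0, lineKernel t (x + v) • R v)
      (Set.Ioc 0 π) := by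
    refine Integrable.mul_bdd (c := C * (√t ^ (0 + J) * absMoment (0 + J))) hφ
      (stronglyMeasurable_integral_lineKernel_smul hRc t).aestronglyMeasurable ?_
    filter_upwards [ae_restrict_mem measurableSet_Ioc] with x hx
    simpa using pow_mul_norm_integral_lineKernel_le hRle 0 hx.1.le ht
  have hHl : ∀ l ∈ Finset.range J, IntegrableOn (fun x =>
      φ x * (boundaryLayer l t x : ℂ) * ((-1) ^ l * s l)) (Set.Ioc 0 π) := fun l _ =>
    (integrableOn_mul_boundaryLayer hφ l ht).mul_const _
  have hcongr : ∀ x ∈ Set.Ioc (0 : ℝ) π,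
      φ x * ∫ v in Set.Ioi 0, lineKernel t (x + v) • σ (-v)
      = ∑ l ∈ Finset.range J, φ x * (boundaryLayer l t x : ℂ) * ((-1) ^ l * s l)
        + φ x * ∫ v in Set.Ioi 0, lineKernel t (x + v) • R v := by
    intro x hx
    rw [hinner x hx, mul_add, Finset.mul_sum]
    congr 1
    exact Finset.sum_congr rfl fun l _ => by ring
  have houter : ∫ x in Set.Ioc 0 π, φ x * ∫ v in Set.Ioi 0, lineKernel t (x + v) • σ (-v)
      = ∑ l ∈ Finset.range J,
          (∫ x in Set.Ioc 0 π, φ x * (boundaryLayer l t x : ℂ)) * ((-1) ^ l * s l)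
        + ∫ x in Set.Ioc 0 π, φ x * ∫ v in Set.Ioi 0, lineKernel t (x + v) • R v := by
    simp_rw [← integral_mul_const]
    rw [← integral_finsetSum _ hHl, ← integral_add (integrable_finsetSum _ hHl) hHR]
    exact setIntegral_congr_fun measurableSet_Ioc hcongr
  refine ⟨IntegrableOn.congr_fun (Integrable.add (integrable_finsetSum _ hHl) hHR)
    (fun x hx => (hcongr x hx).symm) measurableSet_Ioc, ?_⟩
  have hsum : ∑ l ∈ Finset.range J, ∑ k ∈ Finset.range (J - l),
      (t : ℂ) ^ ((1 + ((k + l : ℕ) : ℂ) - α) / 2) * (c k l α * taylorCoeff F k * s l)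
      = -∑ l ∈ Finset.range J, (∑ k ∈ Finset.range (J - l),
          (t : ℂ) ^ ((1 + ((k + l : ℕ) : ℂ) - α) / 2) *
            ((-1) ^ (l + 1) * c k l α * taylorCoeff F k)) * ((-1) ^ l * s l) := by
    rw [← Finset.sum_neg_distrib]
    refine Finset.sum_congr rfl fun l _ => ?_
    rw [Finset.sum_mul, ← Finset.sum_neg_distrib]
    refine Finset.sum_congr rfl fun k _ => ?_
    have : ((-1 : ℂ) ^ l) * (-1) ^ l = 1 := by rw [← pow_add, Even.neg_one_pow ⟨l, rfl⟩]
    linear_combination (-(t : ℂ) ^ ((1 + ((k + l : ℕ) : ℂ) - α) / 2) *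
      (c k l α * taylorCoeff F k * s l)) * this
  rw [houter, hsum, add_right_comm, ← sub_eq_add_neg, ← Finset.sum_sub_distrib, add_mul,
    Finset.sum_mul]
  refine (norm_add_le _ _).trans (add_le_add ?_ ?_)
  · refine norm_sum_le_of_le _ fun l hl => ?_
    rw [← sub_mul, norm_mul, mul_right_comm]
    gcongr
    have := hA l t ht ht1
    rwa [Nat.sub_add_cancel (Finset.mem_range.1 hl).le] at this
  · rw [mul_right_comm, ← integral_const_mul]
    refine norm_integral_le_of_norm_le (hφ.norm.const_mul _) ?_
    filter_upwards [ae_restrict_mem measurableSet_Ioc] with x hx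
    rw [norm_mul, mul_comm]
    gcongr
    have := pow_mul_norm_integral_lineKernel_le hRle 0 hx.1.le ht
    rw [pow_zero, one_mul, zero_add] at this
    exact this.trans (le_of_eq (by ring))

/-! ### The heat content -/

theorem sum_range_sum_antidiagonal (f : ℕ → ℕ → ℂ) (J : ℕ) :
    ∑ j ∈ Finset.range J, ∑ p ∈ Finset.HasAntidiagonal.antidiagonal j, f p.1 p.2
      = ∑ l ∈ Finset.range J, ∑ k ∈ Finset.range (J - l), f k l := by
  induction J with
  | zero => simp
  | succ J ih =>
    have h1 : ∀ l ∈ Finset.range (J + 1), ∑ k ∈ Finset.range (J + 1 - l), f k l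
        = ∑ k ∈ Finset.range (J - l), f k l + f (J - l) l := by
      intro l hl
      rw [Nat.sub_add_comm (Finset.mem_range_succ_iff.1 hl), Finset.sum_range_succ]
    rw [Finset.sum_range_succ, ih, Finset.sum_congr rfl h1, Finset.sum_add_distrib,
      Finset.sum_range_succ (fun l => ∑ k ∈ Finset.range (J - l), f k l), Nat.sub_self,
      Finset.sum_range_zero, add_zero, ← Finset.Nat.sum_antidiagonal_swap,
      ← Finset.Nat.sum_antidiagonal_eq_sum_range_succ (fun l k => f k l)]
    rfl

theorem opD_iterate (f : ℝ → ℂ) (n : ℕ) :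
    opD^[n] f = fun x => (-1) ^ n * iteratedDeriv (2 * n) f x := by
  induction n with
  | zero => simp
  | succ n ih =>
    rw [Function.iterate_succ_apply', ih]
    funext x
    have h1 : deriv (fun x => (-1 : ℂ) ^ n * iteratedDeriv (2 * n) f x)
        = fun x => (-1) ^ n * iteratedDeriv (2 * n + 1) f x := by
      funext y
      rw [deriv_const_mul_field, iteratedDeriv_succ]
    rw [opD, h1, deriv_const_mul_field, ← iteratedDeriv_succ, pow_succ, mul_add, mul_one]
    ring

/-- The values of `opD^[n] ρ` at the endpoints, where `ρ` need not be differentiable on both sides,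
do not matter for the integral. -/
theorem interiorCoeff_eq {φ ρ r : ℝ → ℂ} (hr : Set.EqOn r ρ (Set.Icc 0 π)) (n : ℕ) :
    interiorCoeff φ ρ n
      = (1 / (n.factorial : ℂ)) * ∫ x in Set.Ioc 0 π, φ x * iteratedDeriv (2 * n) r x := by
  have h : ∫ x in Set.Ioo 0 π, φ x * (opD^[n] ρ) x
      = (-1) ^ n * ∫ x in Set.Ioo 0 π, φ x * iteratedDeriv (2 * n) r x := by
    rw [← integral_const_mul]
    refine setIntegral_congr_fun measurableSet_Ioo fun x hx => ?_
    have he : ρ =ᶠ[𝓝 x] r := by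
      filter_upwards [Icc_mem_nhds hx.1 hx.2] with y hy using (hr hy).symm
    simp only [opD_iterate, he.iteratedDeriv_eq]
    ring
  rw [interiorCoeff, intervalIntegral.integral_of_le Real.pi_pos.le, integral_Ioc_eq_integral_Ioo,
    h, integral_Ioc_eq_integral_Ioo, ← mul_assoc, div_mul_eq_mul_div, ← pow_add,
    Even.neg_one_pow ⟨n, rfl⟩]

theorem circleKernel_coe_coe (x y t : ℝ) :
    circleKernel (x : S1) (y : S1) t = circleKernel ((x - y : ℝ) : S1) 0 t := by
  simp [circleKernel]

theorem continuous_circleKernel {t : ℝ} (ht : 0 < t) :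
    Continuous fun p : ℝ × ℝ => circleKernel (p.1 : S1) (p.2 : S1) t := by
  have hcoe : Continuous fun y : ℝ => (y : S1) := AddCircle.continuous_mk' _
  rw [← continuousOn_univ]
  exact continuousOn_circleKernel.comp (f := fun p : ℝ × ℝ => ((p.1 : S1), (p.2 : S1), t))
    (by fun_prop) fun _ _ => ht

theorem integral_Ioi_eq_integral_Ioi_add (f : ℝ → ℂ) (a : ℝ) :
    ∫ y in Set.Ioi a, f y = ∫ v in Set.Ioi 0, f (a + v) := by
  have h := (measurePreserving_add_left volume a).setIntegral_preimage_emb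
    (measurableEmbedding_addLeft a) f (Set.Ioi a)
  rw [Set.preimage_const_add_Ioi, sub_self] at h
  exact h.symm

/-- The heat flow from `[0, π]` on the line is the heat flow from the whole line minus the
contributions of the two half-lines. -/
theorem integral_Ioc_lineKernel_smul {M : ℕ} {r : ℝ → ℂ} {C : ℝ} (hr : ContDiff ℝ M r)
    (hC : ∀ x, ‖iteratedDeriv M r x‖ ≤ C) (x : ℝ) {t : ℝ} (ht : 0 < t) :
    ∫ y in Set.Ioc 0 π, lineKernel t (x - y) • r y = (∫ y, lineKernel t (x - y) • r y)
      - (∫ v in Set.Ioi 0, lineKernel t (x + v) • r (-v))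
      - ∫ v in Set.Ioi 0, lineKernel t (π - x + v) • reflect r (-v) := by
  have hi := integrable_lineKernel_sub_smul hr hC x ht
  have h1 : ∫ v in Set.Ioi 0, lineKernel t (x + v) • r (-v)
      = ∫ y in Set.Iic 0, lineKernel t (x - y) • r y := by
    have := integral_comp_neg_Ioi 0 fun y => lineKernel t (x - y) • r y
    simpa only [sub_neg_eq_add, neg_zero] using this
  have h2 : ∫ v in Set.Ioi 0, lineKernel t (π - x + v) • reflect r (-v)
      = ∫ y in Set.Ioi π, lineKernel t (x - y) • r y := by
    rw [integral_Ioi_eq_integral_Ioi_add _ π]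
    refine integral_congr_ae (Filter.Eventually.of_forall fun v => ?_)
    simp only [reflect, sub_neg_eq_add]
    rw [← lineKernel_neg]
    congr 2
    ring
  have h3 : ∫ y, lineKernel t (x - y) • r y = (∫ y in Set.Iic 0, lineKernel t (x - y) • r y)
      + ∫ y in Set.Ioi 0, lineKernel t (x - y) • r y :=
    (intervalIntegral.integral_Iic_add_Ioi hi.integrableOn hi.integrableOn).symm
  have h4 : ∫ y in Set.Ioi 0, lineKernel t (x - y) • r y
      = (∫ y in Set.Ioc 0 π, lineKernel t (x - y) • r y)
        + ∫ y in Set.Ioi π, lineKernel t (x - y) • r y := by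
    rw [← setIntegral_union (Set.Ioc_disjoint_Ioi le_rfl) measurableSet_Ioi hi.integrableOn
      hi.integrableOn, Set.Ioc_union_Ioi_eq_Ioi Real.pi_pos.le]
  rw [h1, h2, h3, h4]
  ring

theorem norm_iteratedDeriv_reflect (M : ℕ) (r : ℝ → ℂ) (x : ℝ) :
    ‖iteratedDeriv M (reflect r) x‖ = ‖iteratedDeriv M r (π - x)‖ := by
  change ‖iteratedDeriv M (fun z => r (π - z)) x‖ = _
  rw [congrFun (iteratedDeriv_comp_const_sub M r π) x, norm_smul, norm_pow, norm_neg, norm_one,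
    one_pow, one_mul]

/-- On `[0, π]` the heat flow on the circle and the one on the line agree to every order. -/
theorem exists_norm_integral_circleKernel_sub_le (Q : ℕ) {r : ℝ → ℂ} (hr : Continuous r) :
    ∃ A : ℝ, ∀ t : ℝ, 0 < t → t ≤ 1 → ∀ x ∈ Set.Ioc 0 π,
      ‖(∫ y in Set.Ioc 0 π, (circleKernel (x : S1) (y : S1) t : ℂ) * r y)
        - ∫ y in Set.Ioc 0 π, lineKernel t (x - y) • r y‖ ≤ A * t ^ Q := by
  obtain ⟨D, -, hD⟩ := exists_abs_circleKernel_sub_lineKernel_le Q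
  refine ⟨D * ∫ y in Set.Ioc 0 π, ‖r y‖, fun t ht ht1 x hx => ?_⟩
  have hk : Continuous fun y : ℝ => circleKernel (x : S1) (y : S1) t :=
    Continuous.comp (g := fun p : ℝ × ℝ => circleKernel (p.1 : S1) (p.2 : S1) t)
      (f := fun y : ℝ => (x, y)) (continuous_circleKernel ht) (Continuous.prodMk_right x)
  have hl := continuous_lineKernel t
  have hi1 : IntegrableOn (fun y : ℝ => (circleKernel (x : S1) (y : S1) t : ℂ) * r y)
      (Set.Ioc 0 π) :=
    ((Complex.continuous_ofReal.comp hk).mul hr).integrableOn_Icc.mono_set Set.Ioc_subset_Icc_self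
  have hi2 : IntegrableOn (fun y : ℝ => lineKernel t (x - y) • r y) (Set.Ioc 0 π) :=
    (Continuous.integrableOn_Icc (by fun_prop)).mono_set Set.Ioc_subset_Icc_self
  have hir : IntegrableOn r (Set.Ioc 0 π) := hr.integrableOn_Icc.mono_set Set.Ioc_subset_Icc_self
  rw [← integral_sub hi1 hi2, mul_right_comm, ← integral_const_mul]
  refine norm_integral_le_of_norm_le (hir.norm.const_mul _) ?_
  filter_upwards [ae_restrict_mem measurableSet_Ioc] with y hy
  rw [Complex.real_smul, ← sub_mul, ← Complex.ofReal_sub, norm_mul, Complex.norm_real,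
    Real.norm_eq_abs, circleKernel_coe_coe]
  gcongr
  refine hD t ht ht1 _ (abs_le.2 ⟨?_, ?_⟩) <;> linarith [hx.1, hx.2, hy.1, hy.2]

theorem sum_boundary_eq {α : ℂ} {F σ G : ℝ → ℂ} {J : ℕ}
    (hG : ∀ l < J, taylorCoeff G l = iteratedDeriv l σ 0 / (l.factorial : ℂ)) (t : ℝ) :
    ∑ l ∈ Finset.range J, ∑ k ∈ Finset.range (J - l),
      (t : ℂ) ^ ((1 + ((k + l : ℕ) : ℂ) - α) / 2) *
        (c k l α * taylorCoeff F k * (iteratedDeriv l σ 0 / (l.factorial : ℂ)))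
      = ∑ j ∈ Finset.range J, (t : ℂ) ^ ((1 + (j : ℂ) - α) / 2) * endpointCoeff α F G j := by
  rw [Finset.sum_congr rfl fun l hl => Finset.sum_congr rfl fun k _ => by
    rw [← hG l (Finset.mem_range.1 hl)], ← sum_range_sum_antidiagonal (fun k l =>
      (t : ℂ) ^ ((1 + ((k + l : ℕ) : ℂ) - α) / 2) * (c k l α * taylorCoeff F k * taylorCoeff G l))]
  refine Finset.sum_congr rfl fun j _ => ?_
  rw [endpointCoeff, Finset.mul_sum]
  refine Finset.sum_congr rfl fun p hp => ?_
  rw [Finset.HasAntidiagonal.mem_antidiagonal.1 hp]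

/-- The expansion of the heat content up to `O(t^Q)`: replace the kernel by that of the line, extend
`ρ` to the line, and subtract the contributions of the two half-lines outside `[0, π]`. -/
theorem exists_norm_heatContent_sub_le {K : S1 → S1 → ℝ → ℝ} (hK : IsFundamentalSolution K) {α : ℂ}
    (hα : α.re < 1) {φ F₀ Fπ ρ : ℝ → ℂ} (hF₀ : IsRegularPart α φ F₀)
    (hFπ : IsRegularPart α (reflect φ) Fπ) (hρ : ContDiffOn ℝ ∞ ρ (Set.Icc 0 π)) (Q : ℕ) :
    ∃ A : ℝ, ∀ t : ℝ, 0 < t → t ≤ 1 →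
      ‖heatContent K φ ρ t - ∑ n ∈ Finset.range Q, (t : ℂ) ^ n * interiorCoeff φ ρ n
        - ∑ j ∈ Finset.range (2 * Q), (t : ℂ) ^ ((1 + (j : ℂ) - α) / 2)
          * boundaryCoeff α F₀ Fπ ρ j‖ ≤ A * t ^ Q := by
  have hφI := intervalIntegrable_of_isRegularPart hα hF₀ hFπ
  have hφ : IntegrableOn φ (Set.Ioc 0 π) :=
    (intervalIntegrable_iff_integrableOn_Ioc_of_le Real.pi_pos.le).1 hφI
  have hφ' : IntegrableOn (reflect φ) (Set.Ioc 0 π) := by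
    have h := (hφI.comp_sub_left π).symm
    rw [sub_zero, sub_self] at h
    exact (intervalIntegrable_iff_integrableOn_Ioc_of_le Real.pi_pos.le).1 h
  obtain ⟨r, hr, hrρ, C, hC⟩ := exists_contDiff_extension Real.pi_pos (2 * Q) ρ
    (hρ.of_le (natCast_le_infty _))
  have hr' : ContDiff ℝ (2 * Q : ℕ) (reflect r) := hr.comp (contDiff_const.sub contDiff_id)
  have hC' : ∀ x, ‖iteratedDeriv (2 * Q) (reflect r) x‖ ≤ C := fun x => by
    rw [norm_iteratedDeriv_reflect]
    exact hC _
  have hrρ' : Set.EqOn (reflect r) (reflect ρ) (Set.Icc 0 π) := fun x hx =>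
    hrρ ⟨by linarith [hx.2], by linarith [hx.1]⟩
  obtain ⟨A₁, hA₁⟩ := exists_norm_integral_circleKernel_sub_le Q hr.continuous
  obtain ⟨A₂, hA₂⟩ := exists_norm_integral_lineKernel_sub_le hr hC
  obtain ⟨A₃, hA₃⟩ := exists_norm_boundary_integral_sub_le hα hF₀ hφ (2 * Q) hr hC
  obtain ⟨A₄, hA₄⟩ := exists_norm_boundary_integral_sub_le hα hFπ hφ' (2 * Q) hr' hC'
  refine ⟨(A₁ + A₂) * (∫ x in Set.Ioc 0 π, ‖φ x‖) + A₃ + A₄, fun t ht ht1 => ?_⟩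
  obtain ⟨hi₃, hb₃⟩ := hA₃ t ht ht1
  obtain ⟨hi₄, hb₄⟩ := hA₄ t ht ht1
  rw [pow_mul, Real.sq_sqrt ht.le,
    sum_boundary_eq fun l hl => taylorCoeff_eq Real.pi_pos hr hrρ hl.le] at hb₃
  rw [pow_mul, Real.sq_sqrt ht.le,
    sum_boundary_eq fun l hl => taylorCoeff_eq Real.pi_pos hr' hrρ' hl.le] at hb₄
  set H₀ : ℝ → ℂ := fun x => ∫ v in Set.Ioi 0, lineKernel t (x + v) • r (-v) with hH₀
  set H₁ : ℝ → ℂ := fun x => ∫ v in Set.Ioi 0, lineKernel t (x + v) • reflect r (-v) with hH₁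
  set V : ℝ → ℂ := fun x => ∫ y in Set.Ioc 0 π, (circleKernel (x : S1) (y : S1) t : ℂ) * r y with hV
  set S : ℝ → ℂ := fun x =>
    ∑ n ∈ Finset.range Q, (t ^ n / (n.factorial : ℝ)) • iteratedDeriv (2 * n) r x with hS
  replace hi₃ : IntegrableOn (fun x => φ x * H₀ x) (Set.Ioc 0 π) := hi₃
  replace hi₄ : IntegrableOn (fun x => reflect φ x * H₁ x) (Set.Ioc 0 π) := hi₄
  have hcont : heatContent K φ ρ t = ∫ x in Set.Ioc 0 π, φ x * V x := by
    rw [heatContent, intervalIntegral.integral_of_le Real.pi_pos.le]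
    refine setIntegral_congr_fun measurableSet_Ioc fun x _ => ?_
    simp only [hV]
    rw [intervalIntegral.integral_of_le Real.pi_pos.le, ← integral_const_mul]
    refine setIntegral_congr_fun measurableSet_Ioc fun y hy => ?_
    rw [hK.unique isFundamentalSolution_circleKernel _ _ ht, hrρ ⟨hy.1.le, hy.2⟩]
    ring
  have hmulc : ∀ {f : ℝ → ℂ}, Continuous f → IntegrableOn (fun x => φ x * f x) (Set.Ioc 0 π) :=
    fun hf => (((integrableOn_Icc_iff_integrableOn_Ioc (by simp)).2 hφ).mul_continuousOn
      hf.continuousOn isCompact_Icc).mono_set Set.Ioc_subset_Icc_self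
  have hiV : IntegrableOn (fun x => φ x * V x) (Set.Ioc 0 π) := by
    refine hmulc ?_
    have h := intervalIntegral.continuous_parametric_intervalIntegral_of_continuous'
      (μ := volume) (f := fun x y : ℝ => (circleKernel (x : S1) (y : S1) t : ℂ) * r y) (by
        have h1 := continuous_circleKernel ht
        have h2 := hr.continuous
        simp only [Function.uncurry_def]
        fun_prop) 0 π
    simpa only [intervalIntegral.integral_of_le Real.pi_pos.le] using h
  have hin : ∀ n ∈ Finset.range Q, IntegrableOn (fun x =>
      ((t ^ n / (n.factorial : ℝ) : ℝ) : ℂ) * (φ x * iteratedDeriv (2 * n) r x)) (Set.Ioc 0 π) := by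
    intro n hn
    refine Integrable.const_mul (hmulc (hr.continuous_iteratedDeriv (2 * n) ?_)) _
    exact_mod_cast Nat.mul_le_mul_left 2 (Finset.mem_range.1 hn).le
  have hSeq : ∀ x, φ x * S x = ∑ n ∈ Finset.range Q,
      ((t ^ n / (n.factorial : ℝ) : ℝ) : ℂ) * (φ x * iteratedDeriv (2 * n) r x) := by
    intro x
    simp only [hS, Finset.mul_sum, Complex.real_smul]
    exact Finset.sum_congr rfl fun n _ => by ring
  have hiS : IntegrableOn (fun x => φ x * S x) (Set.Ioc 0 π) := by
    simp_rw [hSeq]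
    exact integrable_finsetSum _ hin
  have hSint : ∫ x in Set.Ioc 0 π, φ x * S x
      = ∑ n ∈ Finset.range Q, (t : ℂ) ^ n * interiorCoeff φ ρ n := by
    simp_rw [hSeq]
    rw [integral_finsetSum _ hin]
    refine Finset.sum_congr rfl fun n _ => ?_
    rw [integral_const_mul, interiorCoeff_eq hrρ]
    push_cast
    ring
  have hiH₁ : IntegrableOn (fun x => φ x * H₁ (π - x)) (Set.Ioc 0 π) := by
    have h := ((intervalIntegrable_iff_integrableOn_Ioc_of_le Real.pi_pos.le).2 hi₄).comp_sub_left π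
    rw [sub_zero, sub_self] at h
    simpa only [reflect, sub_sub_cancel] using
      (intervalIntegrable_iff_integrableOn_Ioc_of_le Real.pi_pos.le).1 h.symm
  have hH₁int : ∫ x in Set.Ioc 0 π, reflect φ x * H₁ x = ∫ x in Set.Ioc 0 π, φ x * H₁ (π - x) := by
    rw [← intervalIntegral.integral_of_le Real.pi_pos.le,
      ← intervalIntegral.integral_of_le Real.pi_pos.le]
    have h := intervalIntegral.integral_comp_sub_left (a := 0) (b := π)
      (fun x => φ x * H₁ (π - x)) π
    simpa only [reflect, sub_sub_cancel, sub_self, sub_zero] using h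
  have hErr : ∀ x ∈ Set.Ioc 0 π, ‖V x - (S x - H₀ x - H₁ (π - x))‖ ≤ (A₁ + A₂) * t ^ Q := by
    intro x hx
    have h1 := hA₁ t ht ht1 x hx
    have h2 := hA₂ t ht x
    rw [integral_Ioc_lineKernel_smul hr hC x ht] at h1
    rw [add_mul]
    refine le_trans (le_of_eq ?_) ((norm_add_le _ _).trans (add_le_add h1 h2))
    congr 1
    simp only [hV, hS, hH₀, hH₁]
    ring
  have hErrInt : ‖(∫ x in Set.Ioc 0 π, φ x * V x) - ((∫ x in Set.Ioc 0 π, φ x * S x)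
      - (∫ x in Set.Ioc 0 π, φ x * H₀ x) - ∫ x in Set.Ioc 0 π, φ x * H₁ (π - x))‖
      ≤ (A₁ + A₂) * (∫ x in Set.Ioc 0 π, ‖φ x‖) * t ^ Q := by
    have hi₅ : IntegrableOn (fun x => φ x * S x - φ x * H₀ x) (Set.Ioc 0 π) := hiS.sub hi₃
    have hi₆ : IntegrableOn (fun x => φ x * S x - φ x * H₀ x - φ x * H₁ (π - x)) (Set.Ioc 0 π) :=
      hi₅.sub hiH₁
    rw [← integral_sub hiS hi₃, ← integral_sub hi₅ hiH₁, ← integral_sub hiV hi₆, mul_right_comm,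
      ← integral_const_mul]
    refine norm_integral_le_of_norm_le (hφ.norm.const_mul _) ?_
    filter_upwards [ae_restrict_mem measurableSet_Ioc] with x hx
    have h := hErr x hx
    rw [← mul_sub, ← mul_sub, ← mul_sub, norm_mul, mul_comm]
    gcongr
  rw [hSint, ← hcont, ← hH₁int] at hErrInt
  have hbd : ∑ j ∈ Finset.range (2 * Q), (t : ℂ) ^ ((1 + (j : ℂ) - α) / 2)
      * boundaryCoeff α F₀ Fπ ρ j
      = ∑ j ∈ Finset.range (2 * Q), (t : ℂ) ^ ((1 + (j : ℂ) - α) / 2) * endpointCoeff α F₀ ρ j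
        + ∑ j ∈ Finset.range (2 * Q), (t : ℂ) ^ ((1 + (j : ℂ) - α) / 2)
          * endpointCoeff α Fπ (reflect ρ) j := by
    rw [← Finset.sum_add_distrib]
    exact Finset.sum_congr rfl fun j _ => by rw [boundaryCoeff, mul_add]
  rw [hbd]
  have hdecomp : ∀ b s x₀ x₁ e₀ e₁ : ℂ,
      b - s - (e₀ + e₁) = (b - (s - x₀ - x₁)) + (-(x₀ + e₀)) + (-(x₁ + e₁)) := by
    intros
    ring
  rw [hdecomp _ _ (∫ x in Set.Ioc 0 π, φ x * H₀ x) (∫ x in Set.Ioc 0 π, reflect φ x * H₁ x),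
    add_mul, add_mul]
  refine (norm_add₃_le).trans (add_le_add (add_le_add hErrInt ?_) ?_)
  · rw [norm_neg]
    exact hb₃
  · rw [norm_neg]
    exact hb₄

/-- It suffices to bound the error by arbitrarily high powers of `t` for long truncations: the terms
between two truncations are of the order of the first powers left out. -/
theorem hasHeatExpansion_of_forall_exists {α : ℂ} {β : ℝ → ℂ} {a b : ℕ → ℂ}
    (h : ∀ Q : ℕ, ∃ A : ℝ, ∀ t : ℝ, 0 < t → t ≤ 1 →
      ‖β t - ∑ n ∈ Finset.range Q, (t : ℂ) ^ n * a n
        - ∑ j ∈ Finset.range (2 * Q), (t : ℂ) ^ ((1 + (j : ℂ) - α) / 2) * b j‖ ≤ A * t ^ Q) :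
    HasHeatExpansion α β a b := by
  intro N J
  set Q : ℕ := N + J
  obtain ⟨A, hA⟩ := h Q
  have hev : ∀ᶠ t : ℝ in 𝓝[>] 0, t ∈ Set.Ioc (0 : ℝ) 1 := Ioc_mem_nhdsGT zero_lt_one
  have hsplit : ∀ t : ℝ, β t - ∑ n ∈ Finset.range N, (t : ℂ) ^ n * a n
      - ∑ j ∈ Finset.range J, (t : ℂ) ^ ((1 + (j : ℂ) - α) / 2) * b j
      = (β t - ∑ n ∈ Finset.range Q, (t : ℂ) ^ n * a n
        - ∑ j ∈ Finset.range (2 * Q), (t : ℂ) ^ ((1 + (j : ℂ) - α) / 2) * b j)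
        + ∑ n ∈ Finset.Ico N Q, (t : ℂ) ^ n * a n
        + ∑ j ∈ Finset.Ico J (2 * Q), (t : ℂ) ^ ((1 + (j : ℂ) - α) / 2) * b j := by
    intro t
    rw [Finset.sum_Ico_eq_sub _ (by omega : N ≤ Q), Finset.sum_Ico_eq_sub _ (by omega : J ≤ 2 * Q)]
    ring
  simp_rw [hsplit]
  have hle : ∀ t : ℝ, 0 < t → 0 ≤ t ^ N ∧ 0 ≤ t ^ ((1 + (J : ℝ) - α.re) / 2) := fun t ht =>
    ⟨by positivity, by positivity⟩
  have h₁ : (fun t : ℝ => β t - ∑ n ∈ Finset.range Q, (t : ℂ) ^ n * a n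
      - ∑ j ∈ Finset.range (2 * Q), (t : ℂ) ^ ((1 + (j : ℂ) - α) / 2) * b j)
      =O[𝓝[>] 0] fun t : ℝ => t ^ N + t ^ ((1 + (J : ℝ) - α.re) / 2) := by
    refine Asymptotics.IsBigO.of_bound A ?_
    filter_upwards [hev] with t ht
    obtain ⟨h1, h2⟩ := hle t ht.1
    have hA0 : 0 ≤ A := by simpa using (norm_nonneg _).trans (hA 1 one_pos le_rfl)
    have h3 : t ^ Q ≤ t ^ N := pow_le_pow_of_le_one ht.1.le ht.2 (by omega)
    rw [Real.norm_of_nonneg (add_nonneg h1 h2)]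
    exact (hA t ht.1 ht.2).trans (mul_le_mul_of_nonneg_left (by linarith) hA0)
  have h₂ : ∀ n ∈ Finset.Ico N Q, (fun t : ℝ => (t : ℂ) ^ n * a n)
      =O[𝓝[>] 0] fun t : ℝ => t ^ N + t ^ ((1 + (J : ℝ) - α.re) / 2) := by
    intro n hn
    refine Asymptotics.IsBigO.of_bound ‖a n‖ ?_
    filter_upwards [hev] with t ht
    obtain ⟨h1, h2⟩ := hle t ht.1
    have h3 : t ^ n ≤ t ^ N := pow_le_pow_of_le_one ht.1.le ht.2 (Finset.mem_Ico.1 hn).1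
    rw [Real.norm_of_nonneg (add_nonneg h1 h2), norm_mul, norm_pow, Complex.norm_real,
      Real.norm_of_nonneg ht.1.le, mul_comm]
    exact mul_le_mul_of_nonneg_left (by linarith) (norm_nonneg _)
  have h₃ : ∀ j ∈ Finset.Ico J (2 * Q), (fun t : ℝ => (t : ℂ) ^ ((1 + (j : ℂ) - α) / 2) * b j)
      =O[𝓝[>] 0] fun t : ℝ => t ^ N + t ^ ((1 + (J : ℝ) - α.re) / 2) := by
    intro j hj
    refine Asymptotics.IsBigO.of_bound ‖b j‖ ?_
    filter_upwards [hev] with t ht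
    obtain ⟨h1, h2⟩ := hle t ht.1
    have hre : ((1 + (j : ℂ) - α) / 2).re = (1 + (j : ℝ) - α.re) / 2 := by simp
    have h3 : t ^ ((1 + (j : ℝ) - α.re) / 2) ≤ t ^ ((1 + (J : ℝ) - α.re) / 2) := by
      refine Real.rpow_le_rpow_of_exponent_ge ht.1 ht.2 ?_
      have : (J : ℝ) ≤ j := by exact_mod_cast (Finset.mem_Ico.1 hj).1
      linarith
    rw [Real.norm_of_nonneg (add_nonneg h1 h2), norm_mul, norm_ofReal_cpow ht.1, hre, mul_comm]
    exact mul_le_mul_of_nonneg_left (by linarith) (norm_nonneg _)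
  exact (h₁.add (Asymptotics.IsBigO.fun_sum h₂)).add (Asymptotics.IsBigO.fun_sum h₃)

end CircleHeat

theorem lemma1p4 :
    (∃ K : CircleHeat.S1 → CircleHeat.S1 → ℝ → ℝ, CircleHeat.IsFundamentalSolution K) ∧
    ∀ K : CircleHeat.S1 → CircleHeat.S1 → ℝ → ℝ, CircleHeat.IsFundamentalSolution K →
    ∀ α : ℂ, α.re < 1 →
    ∀ φ F₀ Fπ ρ : ℝ → ℂ,
      CircleHeat.IsRegularPart α φ F₀ →
      CircleHeat.IsRegularPart α (CircleHeat.reflect φ) Fπ →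
      ContDiffOn ℝ ∞ ρ (Set.Icc 0 π) →
      CircleHeat.HasHeatExpansion α (CircleHeat.heatContent K φ ρ)
        (CircleHeat.interiorCoeff φ ρ) (CircleHeat.boundaryCoeff α F₀ Fπ ρ) :=
  ⟨⟨CircleHeat.circleKernel, CircleHeat.isFundamentalSolution_circleKernel⟩,
    fun _ hK _ hα _ _ _ _ hF₀ hFπ hρ =>
    CircleHeat.hasHeatExpansion_of_forall_exists fun Q =>
      CircleHeat.exists_norm_heatContent_sub_le hK hα hF₀ hFπ hρ Q⟩
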